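/- Let $X\subset\mathbb R^d$ and $Y\subset\mathbb R^{d'}$ be compact, where $X$ has connected (non-empty) interior and smooth boundary with outer unit normal $\mathbf n$. Let $\mathcal L$ be the Lebesgue measure on $X$, $\nu$ a Borel probability measure on $Y$, and $\mu$ a probability measure on $X$ with a Lebesgue density, also denoted $\mu$, that is bounded, bounded away from zero, and has finite Fisher information $\int_X|\nabla\sqrt\mu|^2\,dx<\infty$. Let $V\in C^2(X\times Y)$ be non-negative and $\kappa>0$. Let $\Gamma(\mu,\nu)$ be the set of couplings of $\mu$ and $\nu$. Define the energy $$\mathcal E(\rho)=\int_{X\times Y}V\,d\rho+\kappa\int_{X\times Y}(r\log r-r+1)\,dx\,d\nu(y)$$ if $\rho\in\Gamma(\mu,\nu)$ has a density $r$ with respect to $\mathcal L\otimes\nu$, and $\mathcal E(\rho)=+\infty$ otherwise. Let $\rho_\infty\in\Gamma(\mu,\nu)$ have a density $r_\infty\ge 0$ in $L^1(X\times Y,\mathcal L\otimes\nu)$, and let $\Pi_\infty\in H^1(X)$ be the corresponding pressure, that is, $\int_X\Pi_\infty\,d\mu=0$ and $$\int_X\nabla\xi\cdot\nabla\Pi_\infty\,d\mu=\int_X\nabla\xi\cdot\Big[\int_Y\nabla_XV(x,y)\,r_\infty(x,y)\,d\nu(y)\Big]dx-\kappa\int_X\Delta\xi\,d\mu$$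 for all $\xi\in C^\infty(X)$ with $\nabla\xi\cdot\mathbf n=0$ on $\partial X$. Suppose that the dissipation $$\mathcal I(\rho_\infty,\Pi_\infty)=\int_{X\times Y}\big|\nabla_X(\kappa\log r_\infty+V-\Pi_\infty)\big|^2\,d\rho_\infty$$ vanishes. Here $\nabla_X$ is the gradient in $x$, and $\nabla_X\log r_\infty$ is understood in the weak sense: for $\nu$-a.e. $y$ the function $r_\infty(\cdot,y)$ is weakly differentiable in the interior of $X$, and $\nabla_Xr_\infty=r_\infty\,\nabla_X\log r_\infty$; if it does not exist, $\mathcal I=+\infty$. Then there is a measurable function $\Psi:Y\to\mathbb R$ such that $$r_\infty(x,y)=\exp\Big(\frac{\Pi_\infty(x)+\Psi(y)-V(x,y)}{\kappa}\Big)\qquad\text{for }\mathcal L\otimes\nu\text{-a.e. }(x,y),$$ and $\rho_\infty$ is the unique minimizer of $\mathcal E$. -/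

import Mathlib

open MeasureTheory Set Filter
open scoped ENNReal Topology ContDiff Gradient RealInnerProductSpace

namespace Multiphase

/-- The Euclidean space of dimension `n`. -/
abbrev Euc (n : ℕ) : Type := EuclideanSpace ℝ (Fin n)

variable {d d' : ℕ}

/-! ### Domains with smooth boundary -/

/-- `φ` is a smooth defining function of the set `X` near its boundary point `x`:
near `x` the set `X` is `{φ ≤ 0}`, and `φ` vanishes with non-zero gradient at `x`. -/
structure IsDefiningFunctionAt (X : Set (Euc d)) (x : Euc d) (φ : Euc d → ℝ) : Prop where
  contDiff : ContDiff ℝ ∞ φ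
  eq_zero : φ x = 0
  gradient_ne_zero : ∇ φ x ≠ 0
  mem_iff : ∀ᶠ z in 𝓝 x, (z ∈ X ↔ φ z ≤ 0)

/-- `X` has a smooth boundary. -/
def HasSmoothBoundary (X : Set (Euc d)) : Prop :=
  ∀ x ∈ frontier X, ∃ φ : Euc d → ℝ, IsDefiningFunctionAt X x φ

/-- `n` is the outer unit normal of `X` at the boundary point `x`. -/
def IsOuterUnitNormal (X : Set (Euc d)) (x n : Euc d) : Prop :=
  ∃ φ : Euc d → ℝ, IsDefiningFunctionAt X x φ ∧ n = ‖∇ φ x‖⁻¹ • ∇ φ x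

/-- Smooth functions `ξ` on `X` (restrictions of smooth functions on the whole space) with
`∇ξ · n = 0` on the boundary of `X`. -/
structure IsNeumannTestFunction (X : Set (Euc d)) (ξ : Euc d → ℝ) : Prop where
  contDiff : ContDiff ℝ ∞ ξ
  normal_derivative : ∀ x ∈ frontier X, ∀ n : Euc d, IsOuterUnitNormal X x n → ⟪∇ ξ x, n⟫ = 0

/-! ### Weak gradients -/

/-- `g` is the weak (distributional) gradient of `f` on the open set `U`. -/
structure HasWeakGradient (U : Set (Euc d)) (f : Euc d → ℝ) (g : Euc d → Euc d) : Prop where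
  locallyIntegrable : LocallyIntegrableOn f U volume
  locallyIntegrable_gradient : LocallyIntegrableOn g U volume
  integral_eq : ∀ φ : Euc d → ℝ, ContDiff ℝ ∞ φ → HasCompactSupport φ → tsupport φ ⊆ U →
    ∫ x in U, f x • ∇ φ x = - ∫ x in U, φ x • g x

open Classical in
/-- The weak gradient of `f` on `U` (it is unique up to null sets); zero if there is none. -/
noncomputable def weakGradient (U : Set (Euc d)) (f : Euc d → ℝ) : Euc d → Euc d :=
  if h : ∃ g, HasWeakGradient U f g then h.choose else 0

/-- `f` belongs to the Sobolev space `H¹(X)`. -/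
def MemH1 (X : Set (Euc d)) (f : Euc d → ℝ) : Prop :=
  MemLp f 2 (volume.restrict X) ∧
    ∃ g, HasWeakGradient (interior X) f g ∧ MemLp g 2 (volume.restrict X)

/-! ### Marginals, couplings, energy -/

/-- The standing assumptions on the first marginal `μ`: it is a probability measure on `X` with a
Lebesgue density `m` that is bounded and bounded away from zero and has finite Fisher
information `∫ |∇√m|² dx < ∞`. -/
structure IsAdmissibleMarginal (X : Set (Euc d)) (μ : Measure (Euc d)) : Prop where
  isProbabilityMeasure : IsProbabilityMeasure μ
  density : ∃ m : Euc d → ℝ, Measurable m ∧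
    (∃ a b : ℝ, 0 < a ∧ ∀ x ∈ X, a ≤ m x ∧ m x ≤ b) ∧
    μ = (volume.restrict X).withDensity (fun x => ENNReal.ofReal (m x)) ∧
    ∃ G, HasWeakGradient (interior X) (fun x => √(m x)) G ∧ MemLp G 2 (volume.restrict X)

/-- The set `Γ(μ, ν)` of couplings of `μ` and `ν`. -/
def couplings (μ : Measure (Euc d)) (ν : Measure (Euc d')) : Set (Measure (Euc d × Euc d')) :=
  {γ | IsProbabilityMeasure γ ∧ γ.map Prod.fst = μ ∧ γ.map Prod.snd = ν}

/-- The reference measure: Lebesgue measure on `X` times `ν`. -/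
noncomputable def refMeasure (X : Set (Euc d)) (ν : Measure (Euc d')) :
    Measure (Euc d × Euc d') :=
  (volume.restrict X).prod ν

/-- The measure with density `r` with respect to the reference measure. -/
noncomputable def measureOfDensity (X : Set (Euc d)) (ν : Measure (Euc d'))
    (r : Euc d × Euc d' → ℝ) : Measure (Euc d × Euc d') :=
  (refMeasure X ν).withDensity (fun z => ENNReal.ofReal (r z))

open Classical in
/-- The entropy `∫ (r log r - r + 1) dx dν`, where `r` is the density of `ρ` with respect to the
reference measure, and `+∞` if `ρ` has no density. The integrand is non-negative. -/
noncomputable def entropy (X : Set (Euc d)) (ν : Measure (Euc d'))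
    (ρ : Measure (Euc d × Euc d')) : ℝ≥0∞ :=
  if ρ ≪ refMeasure X ν then
    ∫⁻ z, ENNReal.ofReal
      ((ρ.rnDeriv (refMeasure X ν) z).toReal * Real.log (ρ.rnDeriv (refMeasure X ν) z).toReal
        - (ρ.rnDeriv (refMeasure X ν) z).toReal + 1) ∂(refMeasure X ν)
  else ⊤

open Classical in
/-- The energy: `∫ V dρ + κ H(ρ)` on `Γ(μ, ν)`, and `+∞` elsewhere (for `V ≥ 0`, `κ > 0`). -/
noncomputable def energy (X : Set (Euc d)) (μ : Measure (Euc d)) (ν : Measure (Euc d'))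
    (V : Euc d × Euc d' → ℝ) (κ : ℝ) (ρ : Measure (Euc d × Euc d')) : ℝ≥0∞ :=
  if ρ ∈ couplings μ ν then
    ∫⁻ z, ENNReal.ofReal (V z) ∂ρ + ENNReal.ofReal κ * entropy X ν ρ
  else ⊤

/-- `a` is the unique minimizer of `J`. The inequality is strict, so `J a` is finite as soon as
there is any other point. -/
def IsUniqueMinimizer {α : Type*} (J : α → ℝ≥0∞) (a : α) : Prop :=
  ∀ b : α, b ≠ a → J a < J b

/-! ### Pressure and dissipation -/

/-- The gradient of `V` in the first variable. -/
noncomputable def gradX (V : Euc d × Euc d' → ℝ) (z : Euc d × Euc d') : Euc d :=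
  ∇ (fun x => V (x, z.2)) z.1

/-- `P` is the pressure of the coupling with density `r`: the `H¹(X)` solution, with zero mean
with respect to `μ`, of the weak elliptic equation
`∇ · (μ ∇P) = κ Δμ + ∇ · (∫ ∇_X V r dν)` with its natural boundary condition. -/
structure IsPressure (X : Set (Euc d)) (μ : Measure (Euc d)) (ν : Measure (Euc d'))
    (V : Euc d × Euc d' → ℝ) (κ : ℝ) (r : Euc d × Euc d' → ℝ) (P : Euc d → ℝ) : Prop where
  memH1 : MemH1 X P
  mean_zero : ∫ x, P x ∂μ = 0
  elliptic : ∀ ξ : Euc d → ℝ, IsNeumannTestFunction X ξ →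
    ∫ x, ⟪∇ ξ x, weakGradient (interior X) P x⟫ ∂μ =
      (∫ x in X, ⟪∇ ξ x, ∫ y, r (x, y) • gradX V (x, y) ∂ν⟫)
        - κ * ∫ x, Laplacian.laplacian ξ x ∂μ

/-- `w = ∇_X log r` in the weak sense: for almost every `y`, the function `r(·, y)` is weakly
differentiable in the interior of `X` with gradient `∇_X r = r w`. This determines `w` almost
everywhere on `{r > 0}`, and allows `r` to vanish. -/
structure HasWeakLogGradientX (X : Set (Euc d)) (ν : Measure (Euc d'))
    (r : Euc d × Euc d' → ℝ) (w : Euc d × Euc d' → Euc d) : Prop where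
  aestronglyMeasurable : AEStronglyMeasurable w (refMeasure X ν)
  hasWeakGradient : ∀ᵐ y ∂ν,
    HasWeakGradient (interior X) (fun x => r (x, y)) (fun x => r (x, y) • w (x, y))

open Classical in
/-- The dissipation `∫ |∇_X (κ log r + V - P)|² dρ`, where `ρ` has density `r`. It is `+∞` if
`∇_X log r` does not exist in the weak sense. -/
noncomputable def dissipation (X : Set (Euc d)) (ν : Measure (Euc d'))
    (V : Euc d × Euc d' → ℝ) (κ : ℝ) (r : Euc d × Euc d' → ℝ) (P : Euc d → ℝ) : ℝ≥0∞ :=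
  if h : ∃ w, HasWeakLogGradientX X ν r w then
    ∫⁻ z, ‖κ • h.choose z + gradX V z - weakGradient (interior X) P z.1‖ₑ ^ 2
      ∂(measureOfDensity X ν r)
  else ⊤

end Multiphase

namespace Multiphase

/-! ### Linear differential equations with integrable coefficients -/

/-! Vanishing dissipation means `κ w + ∇_X V - ∇P = 0` holds `ρ`-almost everywhere. Multiplying by
`r` turns this into `∇_X r = r ∇g` with `g = (P - V) / κ`, valid almost everywhere for the reference
measure, including where `r = 0`. So for almost every `y` the slice `f = r(·, y)` solves the linear
equation `∇f = f ∇g`, and formally `∇(f exp(-g)) = 0`.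

As `P` is only a Sobolev function, `exp(-g)` need not be locally integrable, and a product rule for
weak gradients is not available. The argument therefore runs along segments. In a ball, a weak
gradient gives the fundamental theorem of calculus on almost every segment
(`ae_sub_eq_integral_line`). There the equation is a scalar linear ODE with integrable coefficient,
so `f (x + h) = f x * exp (g (x + h) - g x)` (`eq_mul_exp_of_line`). Hence `f exp(-g)` is almost
everywhere invariant under translations within the ball, thus constant; connectedness of the
interior makes the constant global (`exists_eq_const_mul_exp`).

The slice is now `c(y) exp(g)`. The second marginal `ν` forces it to have mass one, so `c(y)` is the
inverse of the partition function, hence positive and measurable in `y`; this gives `Ψ`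
(`exists_potential`).

For minimality, `P` is `μ`-integrable and `Ψ` is essentially bounded because `V` is, so `∫ (P + Ψ)
dσ` is the same for every coupling `σ`. Up to this constant the energy is `κ ∫ (s log s - s + 1 - s
log r)`, whose integrand is minimal at each point exactly when `s = r` (`one_sub_le_entropy_sub`).
-/

theorem _root_.AbsolutelyContinuousOnInterval.real_exp {f : ℝ → ℝ} {a b : ℝ}
    (hf : AbsolutelyContinuousOnInterval f a b) :
    AbsolutelyContinuousOnInterval (fun t => Real.exp (f t)) a b := by
  obtain ⟨C, hC⟩ := hf.exists_bound
  obtain ⟨K, hK⟩ := (Real.contDiff_exp (n := 1)).contDiffOn.exists_lipschitzOnWith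
    (s := Icc (-C) C) (by simp) (convex_Icc _ _) isCompact_Icc
  have hmaps : ∀ x ∈ uIcc a b, f x ∈ Icc (-C) C := fun x hx =>
    abs_le.1 (by simpa using hC x hx)
  rw [absolutelyContinuousOnInterval_iff] at hf ⊢
  intro ε hε
  -- `K` is a Lipschitz constant of `exp` on the range of `f` and may be zero, hence `K + 1`.
  obtain ⟨δ, hδ, h⟩ := hf (ε / (K + 1)) (by positivity)
  refine ⟨δ, hδ, fun E hE hEδ => ?_⟩
  have h1 := h E hE hEδ
  have h2 : ∑ i ∈ Finset.range E.1, dist (Real.exp (f (E.2 i).1)) (Real.exp (f (E.2 i).2))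
      ≤ K * ∑ i ∈ Finset.range E.1, dist (f (E.2 i).1) (f (E.2 i).2) := by
    rw [Finset.mul_sum]
    refine Finset.sum_le_sum fun i hi => ?_
    have h3 := hE.1 i hi
    exact hK.dist_le_mul _ (hmaps _ h3.1) _ (hmaps _ h3.2)
  have hS : 0 ≤ ∑ i ∈ Finset.range E.1, dist (f (E.2 i).1) (f (E.2 i).2) :=
    Finset.sum_nonneg fun i _ => dist_nonneg
  rw [lt_div_iff₀ (by positivity)] at h1
  nlinarith

/-- A solution of the integral equation `u t = u₀ + ∫₀ᵗ u a` with integrable coefficient `a`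
is given by the exponential formula. -/
theorem add_integral_mul_eq_mul_exp {u a : ℝ → ℝ} {u₀ : ℝ}
    (ha : IntervalIntegrable a volume 0 1)
    (hua : IntervalIntegrable (fun t => u t * a t) volume 0 1)
    (hu : ∀ᵐ t, t ∈ Ioc (0 : ℝ) 1 → u t = u₀ + ∫ s in 0..t, u s * a s) :
    u₀ + ∫ s in 0..1, u s * a s = u₀ * Real.exp (∫ s in 0..1, a s) := by
  have h0 : (0 : ℝ) ∈ uIcc (0 : ℝ) 1 := by simp
  have hA := ha.absolutelyContinuousOnInterval_intervalIntegral h0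
  have hU := hua.absolutelyContinuousOnInterval_intervalIntegral h0
  have hc : AbsolutelyContinuousOnInterval (fun _ : ℝ => u₀) 0 1 :=
    contDiffOn_const.absolutelyContinuousOnInterval
  -- Integrating factor: `(u₀ + ∫ u a) exp(-∫ a)` is absolutely continuous with derivative zero
  -- almost everywhere, hence constant. The function `u` itself only has to agree with its
  -- continuous version almost everywhere.
  have hprod := (hc.fun_add hU).fun_mul (hA.fun_neg.real_exp)
  obtain ⟨C, hC⟩ := hprod.const_of_ae_hasDerivAt_zero (by
    filter_upwards [ha.ae_hasDerivAt_integral, hua.ae_hasDerivAt_integral, hu,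
      (measure_eq_zero_iff_ae_notMem.1 (measure_singleton (0 : ℝ)) : ∀ᵐ t : ℝ, t ∉ ({0} : Set ℝ))]
      with t h1 h2 h3 h4 ht
    have hA' := h1 ht 0 h0
    have hU' := h2 ht 0 h0
    rw [uIcc_of_le zero_le_one] at ht
    have ht0 : t ∈ Ioc (0 : ℝ) 1 := ⟨lt_of_le_of_ne ht.1 (Ne.symm h4), ht.2⟩
    have := (hU'.const_add u₀).mul hA'.neg.exp
    convert! this using 1
    rw [h3 ht0]
    ring)
  have e0 := hC 0 (by simp)
  have e1 := hC 1 (by simp)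
  rw [← e0] at e1
  simp only [intervalIntegral.integral_same, add_zero, neg_zero, Real.exp_zero, mul_one,
    Real.exp_neg] at e1
  field_simp at e1
  exact e1

/-! ### Weakly differentiable functions along segments -/

/-- The map `(s, x) ↦ (s, x + s h)` preserves product measures whose second factor is Lebesgue. -/
theorem measurePreserving_shear {d : ℕ} (τ : Measure ℝ) [SFinite τ] (h : Euc d) :
    MeasurePreserving (fun p : ℝ × Euc d => (p.1, p.2 + p.1 • h))
      (τ.prod volume) (τ.prod volume) :=
  (MeasurePreserving.id τ).skew_product (g := fun s x => x + s • h) (by fun_prop)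
    (ae_of_all _ fun s => (measurePreserving_add_right volume (s • h)).map_eq)

theorem integrable_comp_shear {d : ℕ} {F : Type*} [NormedAddCommGroup F] {a : Euc d → F}
    (ha : Integrable a) (h : Euc d) :
    Integrable (fun p : ℝ × Euc d => a (p.2 + p.1 • h))
      ((volume.restrict (Ioc (0 : ℝ) 1)).prod volume) :=
  (measurePreserving_shear (volume.restrict (Ioc (0 : ℝ) 1)) h).integrable_comp_of_integrable
    (ha.comp_snd _)

/-- Fubini after a shear: a null set meets almost every segment in direction `h` in a null set of
parameters. This makes statements along segments insensitive to the choice of representatives. -/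
theorem ae_comp_shear {d : ℕ} {p : Euc d → Prop} (hp : ∀ᵐ x, p x) (h : Euc d) :
    ∀ᵐ x : Euc d, ∀ᵐ s ∂(volume.restrict (Ioc (0 : ℝ) 1)), p (x + s • h) := by
  have h1 : ∀ᵐ q ∂((volume.restrict (Ioc (0 : ℝ) 1)).prod (volume : Measure (Euc d))), p q.2 :=
    Measure.quasiMeasurePreserving_snd.ae hp
  have h2 := (measurePreserving_shear (volume.restrict (Ioc (0 : ℝ) 1)) h).quasiMeasurePreserving.ae h1
  have h3 := (Measure.measurePreserving_swap (μ := (volume : Measure (Euc d)))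
    (ν := volume.restrict (Ioc (0 : ℝ) 1))).quasiMeasurePreserving.ae h2
  exact Measure.ae_ae_of_ae_prod h3

theorem ae_intervalIntegrable_line {d : ℕ} {a : Euc d → ℝ} (ha : Integrable a) (h : Euc d) :
    ∀ᵐ x : Euc d, IntervalIntegrable (fun s => a (x + s • h)) volume 0 1 := by
  filter_upwards [(integrable_comp_shear ha h).swap.prod_right_ae] with x hx
  rw [intervalIntegrable_iff_integrableOn_Ioc_of_le zero_le_one]
  exact hx

/-- A function with an integrable weak derivative `a` in direction `h` on a convex open set satisfies
the fundamental theorem of calculus along almost every segment in direction `h`. -/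
theorem ae_sub_eq_integral_line {d : ℕ} {f a : Euc d → ℝ} {h : Euc d} {B : Set (Euc d)}
    (hBo : IsOpen B) (hBc : Convex ℝ B) (hf : Integrable f) (ha : Integrable a)
    (hw : ∀ φ : Euc d → ℝ, ContDiff ℝ ∞ φ → HasCompactSupport φ → tsupport φ ⊆ B →
      ∫ x, f x * fderiv ℝ φ x h = - ∫ x, φ x * a x) :
    ∀ᵐ x, x ∈ B → x + h ∈ B → f (x + h) - f x = ∫ s in 0..1, a (x + s • h) := by
  set I : Measure ℝ := volume.restrict (Ioc (0 : ℝ) 1) with hI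
  have hk3 : Integrable (fun x => ∫ s, a (x + s • h) ∂I) :=
    (integrable_comp_shear ha h).integral_prod_right
  have hfh : Integrable (fun x => f (x + h)) := hf.comp_add_right h
  have hk : Integrable (fun x => f (x + h) - f x - ∫ s, a (x + s • h) ∂I) := (hfh.sub hf).sub hk3
  -- On this set of starting points both endpoints lie in `B`. It suffices to test the identity
  -- against smooth `φ` supported there, moving all translations onto `φ`.
  have hW : IsOpen (B ∩ (fun x => x + h) ⁻¹' B) :=
    hBo.inter (hBo.preimage (by fun_prop))
  have key := hW.ae_eq_zero_of_integral_contDiff_smul_eq_zero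
    (hk.locallyIntegrable.locallyIntegrableOn _) (μ := volume) ?_
  · filter_upwards [key] with x hx hx1 hx2
    rw [intervalIntegral.integral_of_le zero_le_one]
    exact sub_eq_zero.1 (hx ⟨hx1, hx2⟩)
  intro φ hφ hφc hφs
  have hφcont := hφ.continuous
  have hDcont : Continuous (fun x => fderiv ℝ φ x h) :=
    (hφ.continuous_fderiv (by simp)).clm_apply continuous_const
  obtain ⟨C, hC⟩ := hφc.exists_bound_of_continuous hφcont
  obtain ⟨D, hD⟩ := (hφc.fderiv_apply (𝕜 := ℝ) h).exists_bound_of_continuous hDcont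
  -- the slices
  have hslice : ∀ s ∈ Ioc (0 : ℝ) 1,
      ∫ x, φ x * a (x + s • h) = - ∫ x, f x * fderiv ℝ φ (x - s • h) h := by
    intro s hs
    have e1 : ∫ x, φ x * a (x + s • h) = ∫ x, φ (x - s • h) * a x := by
      rw [← integral_add_right_eq_self (fun x => φ (x - s • h) * a x) (s • h)]
      simp
    have e2 := hw (fun x => φ (x - s • h)) (hφ.comp (contDiff_id.sub contDiff_const))
      (hφc.comp_homeomorph (Homeomorph.subRight (s • h))) ?_
    · simp only [fderiv_comp_sub] at e2
      rw [e1, e2, neg_neg]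
    · intro x hx
      have hx' : x - s • h ∈ tsupport φ :=
        tsupport_comp_subset_preimage φ (f := fun x => x - s • h) (by fun_prop) hx
      -- The points `x - s h` and `x - s h + h` lie in `B`, and `x` lies between them; by convexity
      -- the translated test function is still supported in `B`.
      have h1 := hφs hx'
      have h2 := hBc h1.1 h1.2 (sub_nonneg.2 hs.2) hs.1.le (by ring)
      convert h2 using 1
      module
  have hint1 : Integrable (fun p : ℝ × Euc d => φ p.2 * a (p.2 + p.1 • h)) (I.prod volume) :=
    (integrable_comp_shear ha h).bdd_mul (by fun_prop) (ae_of_all _ fun p => hC p.2)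
  have hint2 : Integrable (fun p : ℝ × Euc d => f p.2 * fderiv ℝ φ (p.2 - p.1 • h) h)
      (I.prod volume) :=
    (hf.comp_snd I).mul_bdd
      (hDcont.comp (by fun_prop : Continuous fun p : ℝ × Euc d => p.2 - p.1 • h)).aestronglyMeasurable
      (ae_of_all _ fun p => hD _)
  have hftc : ∀ x, ∫ s, fderiv ℝ φ (x - s • h) h ∂I = φ x - φ (x - h) := by
    intro x
    rw [hI, ← intervalIntegral.integral_of_le zero_le_one]
    have hd : ∀ s : ℝ, HasDerivAt (fun s : ℝ => - φ (x - s • h)) (fderiv ℝ φ (x - s • h) h) s := by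
      intro s
      have h1 : HasDerivAt (fun s : ℝ => x - s • h) (-h) s := by
        simpa using ((hasDerivAt_id s).smul_const h).const_sub x
      have h2 := ((hφ.differentiable (by simp)) (x - s • h)).hasFDerivAt.comp_hasDerivAt s h1
      convert! h2.neg using 1
      simp
    rw [intervalIntegral.integral_eq_sub_of_hasDerivAt (fun s _ => hd s)]
    · simp; ring
    · exact (hDcont.comp (by fun_prop : Continuous fun s : ℝ => x - s • h)).intervalIntegrable _ _
  have hmain : ∫ x, φ x * ∫ s, a (x + s • h) ∂I = ∫ x, f x * (φ (x - h) - φ x) := by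
    calc ∫ x, φ x * ∫ s, a (x + s • h) ∂I
        = ∫ x : Euc d, ∫ s, φ x * a (x + s • h) ∂I := by simp_rw [integral_const_mul]
      _ = ∫ s, (∫ x, φ x * a (x + s • h)) ∂I := (integral_integral_swap hint1).symm
      _ = ∫ s, (- ∫ x, f x * fderiv ℝ φ (x - s • h) h) ∂I :=
          setIntegral_congr_fun measurableSet_Ioc hslice
      _ = - ∫ x : Euc d, ∫ s, f x * fderiv ℝ φ (x - s • h) h ∂I := by
          rw [integral_neg, integral_integral_swap hint2]
      _ = ∫ x, f x * (φ (x - h) - φ x) := by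
          simp_rw [integral_const_mul, hftc]
          rw [← integral_neg]
          congr 1; ext x; ring
  have i1 : Integrable (fun x => φ x * f (x + h)) :=
    hfh.bdd_mul hφcont.aestronglyMeasurable (ae_of_all _ hC)
  have i2 : Integrable (fun x => φ x * f x) :=
    hf.bdd_mul hφcont.aestronglyMeasurable (ae_of_all _ hC)
  have i3 : Integrable (fun x => φ x * ∫ s, a (x + s • h) ∂I) :=
    hk3.bdd_mul hφcont.aestronglyMeasurable (ae_of_all _ hC)
  have i4 : Integrable (fun x => f x * φ (x - h)) :=
    hf.mul_bdd (by fun_prop) (ae_of_all _ fun x => hC (x - h))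
  have i5 : Integrable (fun x => f x * φ x) :=
    hf.mul_bdd (by fun_prop) (ae_of_all _ hC)
  have e1 : ∫ x, φ x * f (x + h) = ∫ x, f x * φ (x - h) := by
    rw [← integral_add_right_eq_self (fun x => f x * φ (x - h)) h]
    simp [mul_comm]
  simp only [smul_eq_mul, mul_sub]
  rw [integral_sub (f := fun x => φ x * f (x + h) - φ x * f x) (i1.sub i2) i3, integral_sub i1 i2, hmain, e1]
  simp only [mul_sub]
  rw [integral_sub i4 i5]
  simp [mul_comm]

/-- `F` is the gradient of `f` on `B` in the sense that, in each direction `h`, the fundamental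
theorem of calculus holds on almost every segment with endpoints in `B`. -/
def IsLineGradientOn {d : ℕ} (B : Set (Euc d)) (f : Euc d → ℝ) (F : Euc d → Euc d) : Prop :=
  ∀ h : Euc d, ∀ᵐ x, x ∈ B → x + h ∈ B → f (x + h) - f x = ∫ s in 0..1, ⟪F (x + s • h), h⟫

theorem add_smul_mem_of_convex {d : ℕ} {B : Set (Euc d)} (hBc : Convex ℝ B) {x h : Euc d}
    (hx : x ∈ B) (hxh : x + h ∈ B) {s : ℝ} (h0 : 0 ≤ s) (h1 : s ≤ 1) : x + s • h ∈ B := by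
  have h2 := hBc hx hxh (sub_nonneg.2 h1) h0 (by ring)
  convert h2 using 1
  module

theorem ae_add_right {d : ℕ} {p : Euc d → Prop} (hp : ∀ᵐ x, p x) (h : Euc d) :
    ∀ᵐ x, p (x + h) :=
  (measurePreserving_add_right volume h).quasiMeasurePreserving.ae hp

theorem IsLineGradientOn.congr_ae {d : ℕ} {B : Set (Euc d)} (hBc : Convex ℝ B)
    {f f' : Euc d → ℝ} {F F' : Euc d → Euc d} (H : IsLineGradientOn B f F)
    (hf : ∀ᵐ x, x ∈ B → f x = f' x) (hF : ∀ᵐ x, x ∈ B → F x = F' x) :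
    IsLineGradientOn B f' F' := by
  intro h
  filter_upwards [H h, hf, ae_add_right hf h, ae_comp_shear hF h] with x h1 h2 h3 h4 hx hxh
  rw [← h2 hx, ← h3 hxh, h1 hx hxh, intervalIntegral.integral_of_le zero_le_one,
    intervalIntegral.integral_of_le zero_le_one]
  refine integral_congr_ae ?_
  filter_upwards [h4, ae_restrict_mem measurableSet_Ioc] with s hs hs'
  rw [hs (add_smul_mem_of_convex hBc hx hxh hs'.1.le hs'.2)]

theorem ae_intervalIntegrable_inner_line {d : ℕ} {B : Set (Euc d)} (hBm : MeasurableSet B)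
    (hBc : Convex ℝ B) {F : Euc d → Euc d} (hF : IntegrableOn F B) (h : Euc d) :
    ∀ᵐ x : Euc d, x ∈ B → x + h ∈ B →
      IntervalIntegrable (fun s => ⟪F (x + s • h), h⟫) volume 0 1 := by
  have h1 : Integrable (fun x => ⟪B.indicator F x, h⟫) :=
    ((integrable_indicator_iff hBm).2 hF).inner_const h
  filter_upwards [ae_intervalIntegrable_line h1 h] with x hx hxB hxh
  rw [intervalIntegrable_iff_integrableOn_Ioc_of_le zero_le_one] at hx ⊢
  refine hx.congr_fun (fun s hs => ?_) measurableSet_Ioc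
  simp only
  rw [indicator_of_mem (add_smul_mem_of_convex hBc hxB hxh hs.1.le hs.2)]

theorem IsLineGradientOn.sub {d : ℕ} {B : Set (Euc d)} (hBm : MeasurableSet B)
    (hBc : Convex ℝ B) {f g : Euc d → ℝ} {F G : Euc d → Euc d}
    (hf : IsLineGradientOn B f F) (hg : IsLineGradientOn B g G)
    (hF : IntegrableOn F B) (hG : IntegrableOn G B) :
    IsLineGradientOn B (fun x => f x - g x) (fun x => F x - G x) := by
  intro h
  filter_upwards [hf h, hg h, ae_intervalIntegrable_inner_line hBm hBc hF h,
    ae_intervalIntegrable_inner_line hBm hBc hG h] with x h1 h2 h3 h4 hx hxh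
  simp only [inner_sub_left]
  rw [intervalIntegral.integral_sub (h3 hx hxh) (h4 hx hxh), ← h1 hx hxh, ← h2 hx hxh]
  ring

theorem IsLineGradientOn.const_mul {d : ℕ} {B : Set (Euc d)} {f : Euc d → ℝ}
    {F : Euc d → Euc d} (hf : IsLineGradientOn B f F) (c : ℝ) :
    IsLineGradientOn B (fun x => c * f x) (fun x => c • F x) := by
  intro h
  filter_upwards [hf h] with x h1 hx hxh
  simp only [inner_smul_left, RCLike.conj_to_real]
  rw [intervalIntegral.integral_const_mul, ← h1 hx hxh]
  ring

theorem isLineGradientOn_of_hasGradientAt {d : ℕ} {B : Set (Euc d)} (hBc : Convex ℝ B)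
    {f : Euc d → ℝ} {F : Euc d → Euc d} (hf : ∀ x ∈ B, HasGradientAt f (F x) x)
    (hF : ContinuousOn F B) : IsLineGradientOn B f F := by
  intro h
  refine ae_of_all _ fun x hx hxh => ?_
  have hmem : ∀ s ∈ uIcc (0 : ℝ) 1, x + s • h ∈ B := fun s hs => by
    rw [uIcc_of_le zero_le_one] at hs
    exact add_smul_mem_of_convex hBc hx hxh hs.1 hs.2
  have hline : Continuous fun s : ℝ => x + s • h := by fun_prop
  rw [intervalIntegral.integral_eq_sub_of_hasDerivAt (f := fun s => f (x + s • h))]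
  · simp
  · intro s hs
    have h1 : HasDerivAt (fun s : ℝ => x + s • h) h s := by
      simpa using ((hasDerivAt_id s).smul_const h).const_add x
    have h2 := (hf _ (hmem s hs)).hasFDerivAt.comp_hasDerivAt s h1
    simpa using! h2
  · exact ((hF.comp hline.continuousOn hmem).inner continuousOn_const).intervalIntegrable

/-- Extend `f` and `G` by zero outside `B`: test functions supported in `B` do not see the change.
Pairing the vector identity with `h` gives the directional weak derivative needed for the segment
formula. -/
theorem HasWeakGradient.isLineGradientOn {d : ℕ} {U B : Set (Euc d)} {f : Euc d → ℝ}
    {G : Euc d → Euc d} (H : HasWeakGradient U f G) (hBo : IsOpen B) (hBc : Convex ℝ B)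
    (hBU : B ⊆ U) (hf : IntegrableOn f B) (hG : IntegrableOn G B) : IsLineGradientOn B f G := by
  intro h
  have hf' := (integrable_indicator_iff hBo.measurableSet).2 hf
  have hG' := (integrable_indicator_iff hBo.measurableSet).2 hG
  have hline := ae_sub_eq_integral_line hBo hBc (h := h) hf' (hG'.inner_const (𝕜 := ℝ) h) ?_
  · filter_upwards [hline] with x h1 hx hxh
    have h2 := h1 hx hxh
    rw [indicator_of_mem hx, indicator_of_mem hxh] at h2
    rw [h2]
    refine intervalIntegral.integral_congr fun s hs => ?_
    rw [uIcc_of_le zero_le_one] at hs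
    rw [indicator_of_mem (add_smul_mem_of_convex hBc hx hxh hs.1 hs.2)]
  intro φ hφ hφc hφs
  have hgcont : Continuous (∇ φ) :=
    (InnerProductSpace.toDual ℝ (Euc d)).symm.continuous.comp (hφ.continuous_fderiv (by simp))
  have hφ0 : ∀ x ∉ B, φ x = 0 := fun x hx => image_eq_zero_of_notMem_tsupport fun h => hx (hφs h)
  have hg0 : ∀ x ∉ B, ∇ φ x = 0 := fun x hx => by
    have : fderiv ℝ φ x = 0 := by
      by_contra h0
      exact hx (hφs (support_fderiv_subset ℝ h0))
    simp [gradient, this]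
  have hgc : HasCompactSupport (∇ φ) := by
    refine (hφc.fderiv (𝕜 := ℝ)).mono fun x hx => ?_
    contrapose! hx
    simp only [Function.mem_support, not_not] at hx ⊢
    simp [gradient, hx]
  obtain ⟨C, hC⟩ := hφc.exists_bound_of_continuous hφ.continuous
  obtain ⟨D, hD⟩ := hgc.exists_bound_of_continuous hgcont
  have key := H.integral_eq φ hφ hφc (hφs.trans hBU)
  have e1 : ∫ x in U, f x • ∇ φ x = ∫ x, B.indicator f x • ∇ φ x := by
    rw [setIntegral_eq_integral_of_forall_compl_eq_zero]
    · refine integral_congr_ae (ae_of_all _ fun x => ?_)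
      by_cases hx : x ∈ B <;> simp [hx, hg0]
    · intro x hx
      simp [hg0 x fun h => hx (hBU h)]
  have e2 : ∫ x in U, φ x • G x = ∫ x, φ x • B.indicator G x := by
    rw [setIntegral_eq_integral_of_forall_compl_eq_zero]
    · refine integral_congr_ae (ae_of_all _ fun x => ?_)
      by_cases hx : x ∈ B <;> simp [hx, hφ0]
    · intro x hx
      simp [hφ0 x fun h => hx (hBU h)]
  rw [e1, e2] at key
  have i1 : Integrable (fun x => B.indicator f x • ∇ φ x) :=
    hf'.smul_bdd D hgcont.aestronglyMeasurable (ae_of_all _ hD)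
  have i2 : Integrable (fun x => φ x • B.indicator G x) :=
    hG'.bdd_smul C hφ.continuous.aestronglyMeasurable (ae_of_all _ hC)
  have k2 := congrArg (fun v => ⟪h, v⟫) key
  simp only [inner_neg_right] at k2
  rw [← integral_inner i1, ← integral_inner i2] at k2
  simp only [inner_smul_right] at k2
  convert k2 using 1
  · refine integral_congr_ae (ae_of_all _ fun x => ?_)
    simp only
    rw [real_inner_comm, inner_gradient_left]
  · simp only [real_inner_comm]

/-! ### The equation `∇f = f ∇g` -/

theorem eq_mul_exp_of_line {d : ℕ} {B : Set (Euc d)} (hBm : MeasurableSet B) (hBc : Convex ℝ B)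
    {f g : Euc d → ℝ} {F : Euc d → Euc d} (hfm : Measurable f) (hFm : Measurable F)
    (hF : Integrable F) (hfF : Integrable (fun x => f x • F x))
    (hf : IsLineGradientOn B f (fun x => f x • F x)) (hg : IsLineGradientOn B g F) (h : Euc d) :
    ∀ᵐ x, x ∈ B → x + h ∈ B → f (x + h) = f x * Real.exp (g (x + h) - g x) := by
  have hint : Measurable (fun p : ℝ × Euc d =>
      ∫ s in 0..1, ⟪f (p.2 + s • p.1 • h) • F (p.2 + s • p.1 • h), p.1 • h⟫) := by
    simp only [intervalIntegral.integral_of_le zero_le_one]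
    refine StronglyMeasurable.measurable (StronglyMeasurable.integral_prod_right'
      (f := fun q : (ℝ × Euc d) × ℝ =>
        ⟪f (q.1.2 + q.2 • q.1.1 • h) • F (q.1.2 + q.2 • q.1.1 • h), q.1.1 • h⟫) ?_)
    refine Measurable.stronglyMeasurable ?_
    fun_prop
  have hmeas : MeasurableSet {p : ℝ × Euc d | p.2 ∈ B → p.2 + p.1 • h ∈ B →
      f (p.2 + p.1 • h) - f p.2 =
        ∫ s in 0..1, ⟪f (p.2 + s • p.1 • h) • F (p.2 + s • p.1 • h), p.1 • h⟫} := by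
    refine MeasurableSet.imp (measurable_snd hBm) (MeasurableSet.imp ?_ ?_)
    · exact (by fun_prop : Measurable fun p : ℝ × Euc d => p.2 + p.1 • h) hBm
    · exact measurableSet_eq_fun (by fun_prop) hint
  -- The exceptional set of starting points depends on the step `s h`. Fubini gives, for almost
  -- every `x`, the formula for almost every `s`, which is what an integral equation along the ray
  -- requires.
  have hae := (Measure.ae_ae_comm (μ := volume.restrict (Ioc (0 : ℝ) 1)) (ν := volume)
    (p := fun s x => x ∈ B → x + s • h ∈ B → f (x + s • h) - f x =
        ∫ t in 0..1, ⟪f (x + t • s • h) • F (x + t • s • h), s • h⟫) hmeas).1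
    (ae_of_all _ fun s => hf (s • h))
  filter_upwards [hae, hf h, hg h, ae_intervalIntegrable_line (hF.inner_const (𝕜 := ℝ) h) h,
    ae_intervalIntegrable_line (hfF.inner_const (𝕜 := ℝ) h) h] with x h1 h2 h3 h4 h5 hx hxh
  have h2' := h2 hx hxh
  simp only [inner_smul_left, RCLike.conj_to_real] at h1 h2' h5
  have := add_integral_mul_eq_mul_exp (u := fun s => f (x + s • h))
    (a := fun s => ⟪F (x + s • h), h⟫) (u₀ := f x) h4 h5 ?_
  · rw [← h2', ← h3 hx hxh] at this
    linarith
  · rw [ae_restrict_iff' measurableSet_Ioc] at h1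
    filter_upwards [h1] with t ht ht01
    have h6 := ht ht01 hx (add_smul_mem_of_convex hBc hx hxh ht01.1.le ht01.2)
    -- The formula for the step `t h` integrates over `[0, 1]`; rescaling turns it into an integral
    -- over `[0, t]` along the direction `h`.
    have h7 := intervalIntegral.mul_integral_comp_mul_right (a := 0) (b := 1) (c := t)
      (f := fun s => f (x + s • h) * ⟪F (x + s • h), h⟫)
    simp only [zero_mul, one_mul] at h7
    rw [← h7, ← intervalIntegral.integral_const_mul]
    rw [← sub_eq_iff_eq_add', h6]
    refine intervalIntegral.integral_congr fun s _ => ?_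
    simp only [smul_smul, inner_smul_right]
    ring

/-- By Fubini some `x` in `B` is good for almost every `h`; substituting `h = y - x` compares almost
every `y` in `B` with this single `x`. -/
theorem exists_eq_const_of_translation_invariant {d : ℕ} {B : Set (Euc d)} (hBm : MeasurableSet B)
    {u : Euc d → ℝ} (hum : Measurable u)
    (hu : ∀ h : Euc d, ∀ᵐ x, x ∈ B → x + h ∈ B → u (x + h) = u x) :
    ∃ c, ∀ᵐ x, x ∈ B → u x = c := by
  by_cases hB : volume B = 0
  · exact ⟨0, (measure_eq_zero_iff_ae_notMem.1 hB).mono fun x hx hxB => absurd hxB hx⟩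
  have hmeas : MeasurableSet {p : Euc d × Euc d | p.2 ∈ B → p.2 + p.1 ∈ B → u (p.2 + p.1) = u p.2} :=
    MeasurableSet.imp (measurable_snd hBm) (MeasurableSet.imp
      ((by fun_prop : Measurable fun p : Euc d × Euc d => p.2 + p.1) hBm)
      (measurableSet_eq_fun (by fun_prop) (by fun_prop)))
  have hae := (Measure.ae_ae_comm (μ := (volume : Measure (Euc d))) (ν := volume)
    (p := fun h x => x ∈ B → x + h ∈ B → u (x + h) = u x) hmeas).1 (ae_of_all _ hu)
  have hfreq : ∃ᵐ x : Euc d, x ∈ B := frequently_ae_mem_iff.2 hB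
  obtain ⟨x, hxB, hx⟩ := (hfreq.and_eventually hae).exists
  refine ⟨u x, ?_⟩
  filter_upwards [ae_add_right hx (-x)] with y hy hyB
  have e : x + (y + -x) = y := by abel
  rw [e] at hy
  exact hy hxB hyB

theorem exists_eq_const_mul_exp_on_convex {d : ℕ} {B : Set (Euc d)} (hBo : IsOpen B)
    (hBc : Convex ℝ B) {f g : Euc d → ℝ} {F : Euc d → Euc d}
    (hfm : AEMeasurable f (volume.restrict B)) (hgm : AEMeasurable g (volume.restrict B))
    (hF : IntegrableOn F B) (hfF : IntegrableOn (fun x => f x • F x) B)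
    (hf : IsLineGradientOn B f (fun x => f x • F x)) (hg : IsLineGradientOn B g F) :
    ∃ c, ∀ᵐ x, x ∈ B → f x = c * Real.exp (g x) := by
  have hBm := hBo.measurableSet
  have hFm := hF.1.aemeasurable
  set f' := hfm.mk f
  set g' := hgm.mk g
  set F' := B.indicator (hFm.mk F)
  have ef : ∀ᵐ x, x ∈ B → f x = f' x := (ae_restrict_iff' hBm).1 hfm.ae_eq_mk
  have eg : ∀ᵐ x, x ∈ B → g x = g' x := (ae_restrict_iff' hBm).1 hgm.ae_eq_mk
  have eF : ∀ᵐ x, x ∈ B → F x = F' x := by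
    filter_upwards [(ae_restrict_iff' hBm).1 hFm.ae_eq_mk] with x hx hxB
    simp only [F', indicator_of_mem hxB, hx hxB]
  have iF : Integrable F' := by
    rw [integrable_indicator_iff hBm]
    exact hF.congr hFm.ae_eq_mk
  have ifF : Integrable (fun x => f' x • F' x) := by
    have : (fun x => f' x • F' x) = B.indicator (fun x => f' x • F' x) := by
      ext1 x
      by_cases hx : x ∈ B <;> simp [F', hx]
    rw [this, integrable_indicator_iff hBm]
    refine hfF.congr ?_
    filter_upwards [(ae_restrict_iff' hBm).2 ef, (ae_restrict_iff' hBm).2 eF] with x h1 h2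
    rw [h1, h2]
  have hf' : IsLineGradientOn B f' (fun x => f' x • F' x) :=
    hf.congr_ae hBc ef (by filter_upwards [ef, eF] with x h1 h2 hx; rw [h1 hx, h2 hx])
  have hg' : IsLineGradientOn B g' F' := hg.congr_ae hBc eg eF
  have hfm' : Measurable f' := hfm.measurable_mk
  have hgm' : Measurable g' := hgm.measurable_mk
  obtain ⟨c, hc⟩ := exists_eq_const_of_translation_invariant hBm
    (u := fun x => f' x * Real.exp (- g' x)) (by fun_prop) (fun h => by
      filter_upwards [eq_mul_exp_of_line hBm hBc hfm' (hFm.measurable_mk.indicator hBm) iF ifF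
        hf' hg' h] with x hx hxB hxh
      rw [hx hxB hxh, mul_assoc, ← Real.exp_add]
      congr 2
      ring)
  refine ⟨c, ?_⟩
  filter_upwards [hc, ef, eg] with x h1 h2 h3 hx
  rw [h2 hx, h3 hx, ← h1 hx, mul_assoc, ← Real.exp_add]
  simp

/-- A function that is almost everywhere locally constant on a connected open set is almost
everywhere constant. -/
theorem exists_ae_eq_const_of_locally {d : ℕ} {U : Set (Euc d)} (hU : IsPreconnected U)
    {u : Euc d → ℝ}
    (hloc : ∀ x ∈ U, ∃ B, IsOpen B ∧ x ∈ B ∧ B ⊆ U ∧ ∃ c, ∀ᵐ z, z ∈ B → u z = c) :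
    ∃ c, ∀ᵐ z, z ∈ U → u z = c := by
  rcases U.eq_empty_or_nonempty with rfl | ⟨x₀, hx₀⟩
  · exact ⟨0, by simp⟩
  choose! B hBo hxB hBU c hc using hloc
  -- Overlapping neighbourhoods meet in a non-empty open set, which has positive measure, so their
  -- constants agree.
  have hstep : ∀ x ∈ U, ∀ y ∈ U, y ∈ B x → c x = c y := by
    intro x hx y hy hyx
    have hpos : volume (B x ∩ B y) ≠ 0 :=
      (((hBo x hx).inter (hBo y hy)).measure_pos volume ⟨y, hyx, hxB y hy⟩).ne'
    obtain ⟨z, hz, h1, h2⟩ :=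
      ((frequently_ae_mem_iff.2 hpos).and_eventually ((hc x hx).and (hc y hy))).exists
    rw [← h1 hz.1, ← h2 hz.2]
  have hconst : ∀ y ∈ U, c x₀ = c y := fun y hy =>
    hU.induction₂ (fun x y => c x = c y)
      (fun x hx => by
        filter_upwards [self_mem_nhdsWithin, mem_nhdsWithin_of_mem_nhds
          ((hBo x hx).mem_nhds (hxB x hx))] with y hyU hyB
        exact hstep x hx y hyU hyB)
      (fun x y z _ _ _ h1 h2 => h1.trans h2) (fun x y _ _ h => h.symm) hx₀ hy
  refine ⟨c x₀, ?_⟩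
  rw [ae_iff]
  refine measure_null_of_locally_null _ fun x hx => ?_
  simp only [mem_ofPred_eq, Classical.not_imp] at hx
  refine ⟨_, inter_mem_nhdsWithin _ ((hBo x hx.1).mem_nhds (hxB x hx.1)), ?_⟩
  have h1 := hc x hx.1
  rw [ae_iff] at h1
  refine measure_mono_null (fun z hz => ?_) h1
  simp only [mem_inter_iff, mem_ofPred_eq, Classical.not_imp] at hz ⊢
  rw [← hconst x hx.1]
  exact ⟨hz.2, hz.1.2⟩

/-- Solutions of `∇f = f ∇g`, where `g = (P - V) / κ` with `P` weakly and `V` classically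
differentiable, are multiples of `exp g`. -/
theorem exists_eq_const_mul_exp {d : ℕ} {U : Set (Euc d)} (hUo : IsOpen U) (hU : IsPreconnected U)
    {f P V : Euc d → ℝ} {Gf GP GV : Euc d → Euc d} {κ : ℝ}
    (hf : HasWeakGradient U f Gf) (hP : HasWeakGradient U P GP)
    (hV : ∀ x ∈ U, HasGradientAt V (GV x) x) (hGV : ContinuousOn GV U)
    (heq : ∀ᵐ x, x ∈ U → Gf x = f x • κ⁻¹ • (GP x - GV x)) :
    ∃ c, ∀ᵐ x, x ∈ U → f x = c * Real.exp (κ⁻¹ * (P x - V x)) := by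
  have key := exists_ae_eq_const_of_locally hU
    (u := fun x => f x * Real.exp (-(κ⁻¹ * (P x - V x)))) (fun x hx => by
      -- The closed ball is compact inside `U`, so local integrability becomes integrability on the
      -- open ball.
      obtain ⟨ε, hε, hball⟩ := Metric.nhds_basis_closedBall.mem_iff.1 (hUo.mem_nhds hx)
      have hBU : Metric.ball x ε ⊆ U := Metric.ball_subset_closedBall.trans hball
      have hK : IsCompact (Metric.closedBall x ε) := isCompact_closedBall _ _
      have hBc := convex_ball x ε
      have hBm : MeasurableSet (Metric.ball x ε) := measurableSet_ball
      refine ⟨Metric.ball x ε, Metric.isOpen_ball, Metric.mem_ball_self hε, hBU, ?_⟩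
      have loc : ∀ {F : Type} [NormedAddCommGroup F] {a : Euc d → F},
          LocallyIntegrableOn a U volume → IntegrableOn a (Metric.ball x ε) := fun ha =>
        (ha.integrableOn_compact_subset hball hK).mono_set Metric.ball_subset_closedBall
      have iGP := loc hP.locallyIntegrable_gradient
      have iGf := loc hf.locallyIntegrable_gradient
      have iGV : IntegrableOn GV (Metric.ball x ε) :=
        loc (hGV.locallyIntegrableOn hUo.measurableSet)
      have heqB : ∀ᵐ x', x' ∈ Metric.ball x ε → Gf x' = f x' • κ⁻¹ • (GP x' - GV x') :=
        heq.mono fun z hz hzB => hz (hBU hzB)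
      have hVc : ContinuousOn V U := fun z hz => (hV z hz).continuousAt.continuousWithinAt
      obtain ⟨c, hc⟩ := exists_eq_const_mul_exp_on_convex (f := f)
        (g := fun x => κ⁻¹ * (P x - V x)) (F := fun x => κ⁻¹ • (GP x - GV x))
        Metric.isOpen_ball hBc (loc hf.locallyIntegrable).1.aemeasurable
        (((loc hP.locallyIntegrable).1.sub
          (loc (hVc.locallyIntegrableOn hUo.measurableSet)).1).aemeasurable.const_mul κ⁻¹)
        ((iGP.sub iGV).smul κ⁻¹) (iGf.congr ((ae_restrict_iff' hBm).2 heqB))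
        ((hf.isLineGradientOn Metric.isOpen_ball hBc hBU (loc hf.locallyIntegrable) iGf).congr_ae
          hBc (ae_of_all _ fun _ _ => rfl) heqB)
        (((hP.isLineGradientOn Metric.isOpen_ball hBc hBU (loc hP.locallyIntegrable) iGP).sub hBm hBc
          (isLineGradientOn_of_hasGradientAt hBc (fun z hz => hV z (hBU hz)) (hGV.mono hBU))
          iGP iGV).const_mul κ⁻¹)
      refine ⟨c, ?_⟩
      filter_upwards [hc] with z hz hzB
      rw [hz hzB, mul_assoc, ← Real.exp_add]
      simp)
  obtain ⟨c, hc⟩ := key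
  refine ⟨c, ?_⟩
  filter_upwards [hc] with z hz hzU
  rw [← hz hzU, mul_assoc, ← Real.exp_add]
  simp

/-! ### Null boundary -/

/-- The zero set of a smooth function is a null set near points where the gradient is not zero. -/
theorem exists_nhds_zero_set_null {d : ℕ} {φ : Euc d → ℝ} (hφ : ContDiff ℝ ∞ φ) {x : Euc d}
    (hx : ∇ φ x ≠ 0) : ∃ N ∈ 𝓝 x, volume (N ∩ {z | φ z = 0}) = 0 := by
  set e := ∇ φ x
  have hcont : Continuous fun z => fderiv ℝ φ z e :=
    (hφ.continuous_fderiv (by simp)).clm_apply continuous_const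
  have hpos : 0 < fderiv ℝ φ x e := by
    rw [← inner_gradient_left, real_inner_self_eq_norm_sq]
    positivity
  obtain ⟨ε, hε, hball⟩ := Metric.nhds_basis_ball.mem_iff.1
    (hcont.continuousAt.eventually (lt_mem_nhds hpos))
  refine ⟨Metric.ball x ε, Metric.ball_mem_nhds _ hε, ?_⟩
  have hline : ∀ z ∈ Metric.ball x ε, ∀ t : ℝ, 0 < t → z + t • e ∈ Metric.ball x ε →
      φ z = 0 → φ (z + t • e) ≠ 0 := by
    intro z hz t ht hzt h0 h1
    have hd : ∀ s : ℝ, HasDerivAt (fun s : ℝ => φ (z + s • e)) (fderiv ℝ φ (z + s • e) e) s := by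
      intro s
      have h1 : HasDerivAt (fun s : ℝ => z + s • e) e s := by
        simpa using ((hasDerivAt_id s).smul_const e).const_add z
      exact ((hφ.differentiable (by simp)) (z + s • e)).hasFDerivAt.comp_hasDerivAt s h1
    obtain ⟨s, hs, hs0⟩ := exists_hasDerivAt_eq_zero ht
      (fun s _ => (hd s).continuousAt.continuousWithinAt) (by simp [h0, h1]) (fun s _ => hd s)
    have hmem : z + s • e ∈ Metric.ball x ε := by
      have h2 := (convex_ball x ε).add_smul_mem hz hzt (t := s / t)
        ⟨by have := hs.1; positivity, (div_le_one ht).2 hs.2.le⟩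
      rwa [smul_smul, div_mul_cancel₀ _ ht.ne'] at h2
    exact (hball hmem).ne' hs0
  -- By Rolle, a segment in direction `e` inside the ball meets the zero set at most once. The
  -- translates by `e / (n + 1)` are therefore pairwise disjoint, and their shifts are bounded, so
  -- the set is null.
  refine Measure.addHaar_eq_zero_of_disjoint_translates volume
    (fun n : ℕ => ((1 : ℝ) / (n + 1)) • e) ?_ ?_ ?_
  · refine (Metric.isBounded_closedBall (x := (0 : Euc d)) (r := ‖e‖)).subset ?_
    rintro _ ⟨n, rfl⟩
    simp only [Metric.mem_closedBall, dist_zero_right, norm_smul, Real.norm_eq_abs]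
    rw [abs_of_pos (by positivity)]
    have : (1 : ℝ) / (n + 1) ≤ 1 := (div_le_one (by positivity)).2 (by linarith [n.cast_nonneg (α := ℝ)])
    nlinarith [norm_nonneg e]
  · have key : ∀ m n : ℕ, m < n → ∀ y ∈ Metric.ball x ε ∩ {z | φ z = 0},
        ∀ z ∈ Metric.ball x ε ∩ {z | φ z = 0},
        ((1 : ℝ) / (m + 1)) • e + y ≠ ((1 : ℝ) / (n + 1)) • e + z := by
      intro m n hmn y hy z hz h
      have hlt : (1 : ℝ) / (n + 1) < 1 / (m + 1) := by
        have : (m : ℝ) < n := by exact_mod_cast hmn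
        exact one_div_lt_one_div_of_lt (by positivity) (by linarith)
      have hzy : z = y + ((1 : ℝ) / (m + 1) - 1 / (n + 1)) • e := by
        rw [sub_smul]
        rw [eq_comm, ← sub_eq_iff_eq_add'] at h
        rw [← sub_eq_zero] at h ⊢
        rw [← h]
        abel
      refine hline y hy.1 _ (sub_pos.2 hlt) (hzy ▸ hz.1) hy.2 ?_
      rw [← hzy]
      exact hz.2
    intro m n hmn
    rw [Function.onFun, Set.disjoint_left]
    rintro w ⟨_, rfl, y, hy, rfl⟩ ⟨_, rfl, z, hz, hw⟩
    rcases lt_or_gt_of_ne hmn with h | h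
    · exact key m n h y hy z hz hw.symm
    · exact key n m h z hz y hy hw
  · exact measurableSet_ball.inter (hφ.continuous.measurable (measurableSet_singleton 0))

/-- Near a boundary point the frontier lies in the zero set of the defining function: where `φ < 0`
the point is interior to `X`, where `φ > 0` it is outside the closure. -/
theorem HasSmoothBoundary.volume_frontier {d : ℕ} {X : Set (Euc d)} (hX : HasSmoothBoundary X) :
    volume (frontier X) = 0 := by
  refine measure_null_of_locally_null _ fun x hx => ?_
  obtain ⟨φ, h⟩ := hX x hx
  obtain ⟨N, hN, hN0⟩ := exists_nhds_zero_set_null h.contDiff h.gradient_ne_zero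
  refine ⟨frontier X ∩ (N ∩ {z | ∀ᶠ w in 𝓝 z, (w ∈ X ↔ φ w ≤ 0)}), inter_mem_nhdsWithin _
    (inter_mem hN (eventually_eventually_nhds.2 h.mem_iff)), measure_mono_null ?_ hN0⟩
  rintro z ⟨hz, hzN, hzw⟩
  refine ⟨hzN, ?_⟩
  have hc := h.contDiff.continuous.continuousAt (x := z)
  simp only [mem_ofPred_eq] at hzw ⊢
  rcases lt_trichotomy (φ z) 0 with h1 | h1 | h1
  · refine absurd ?_ hz.2
    rw [mem_interior_iff_mem_nhds]
    filter_upwards [hzw, hc.eventually (gt_mem_nhds h1)] with w hw hw0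
    exact hw.2 (le_of_lt hw0)
  · exact h1
  · have : ∀ᶠ w in 𝓝 z, w ∉ X := by
      filter_upwards [hzw, hc.eventually (lt_mem_nhds h1)] with w hw hw0 hwX
      exact absurd (hw.1 hwX) (not_le.2 hw0)
    exact absurd hz.1 (by rw [mem_closure_iff_frequently]; simpa using this)

/-! ### The gradient in the first variable -/

/-- Since `Y` may have empty interior, the derivative of `V` within `X ×ˢ Y` need not be unique. Its
restriction to horizontal directions is a genuine gradient when `x` is interior, and it inherits
continuity from a local `C¹` choice of derivative. -/
theorem exists_local_gradX {d d' : ℕ} {X : Set (Euc d)} {Y : Set (Euc d')}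
    {V : Euc d × Euc d' → ℝ} (hV : ContDiffOn ℝ 2 V (X ×ˢ Y)) {z : Euc d × Euc d'}
    (hz : z ∈ interior X ×ˢ Y) :
    ∃ F : Euc d × Euc d' → Euc d, ContinuousWithinAt F (interior X ×ˢ Y) z ∧
      ∀ᶠ w in 𝓝[interior X ×ˢ Y] z, HasGradientAt (fun x => V (x, w.2)) (F w) w.1 := by
  have hsub : interior X ×ˢ Y ⊆ X ×ˢ Y := prod_mono interior_subset le_rfl
  have h1 : ContDiffWithinAt ℝ (1 + 1) V (X ×ˢ Y) z := by
    rw [one_add_one_eq_two]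
    exact hV z (hsub hz)
  obtain ⟨u, hu, -, -, D, hD, hDc⟩ := (contDiffWithinAt_succ_iff_hasFDerivWithinAt' (by simp)).1 h1
  rw [insert_eq_of_mem (hsub hz)] at hu
  refine ⟨fun w => (InnerProductSpace.toDual ℝ (Euc d)).symm
    ((D w).comp (ContinuousLinearMap.inl ℝ (Euc d) (Euc d'))), ?_, ?_⟩
  · have hc : ContinuousWithinAt D (interior X ×ˢ Y) z := hDc.continuousWithinAt.mono hsub
    exact (InnerProductSpace.toDual ℝ (Euc d)).symm.continuous.continuousAt.comp_continuousWithinAt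
      (hc.clm_comp continuousWithinAt_const)
  · filter_upwards [nhdsWithin_mono z hsub hu, self_mem_nhdsWithin] with w hwu hw
    rw [hasGradientAt_iff_hasFDerivAt, LinearIsometryEquiv.apply_symm_apply]
    have h2 : HasFDerivWithinAt (fun x : Euc d => (x, w.2))
        (ContinuousLinearMap.inl ℝ (Euc d) (Euc d')) X w.1 :=
      (hasFDerivAt_prodMk_left w.1 w.2).hasFDerivWithinAt
    have h3 := (hD w hwu).comp (f := fun x : Euc d => (x, w.2)) w.1 h2 (fun x hx => ⟨hx, hw.2⟩)
    exact h3.hasFDerivAt (mem_interior_iff_mem_nhds.1 hw.1)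

theorem hasGradientAt_gradX {d d' : ℕ} {X : Set (Euc d)} {Y : Set (Euc d')}
    {V : Euc d × Euc d' → ℝ} (hV : ContDiffOn ℝ 2 V (X ×ˢ Y)) {x : Euc d} {y : Euc d'}
    (hx : x ∈ interior X) (hy : y ∈ Y) :
    HasGradientAt (fun x => V (x, y)) (gradX V (x, y)) x := by
  obtain ⟨F, -, hF⟩ := exists_local_gradX hV (z := (x, y)) ⟨hx, hy⟩
  exact (hF.self_of_nhdsWithin ⟨hx, hy⟩).differentiableAt.hasGradientAt

theorem continuousOn_gradX {d d' : ℕ} {X : Set (Euc d)} {Y : Set (Euc d')}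
    {V : Euc d × Euc d' → ℝ} (hV : ContDiffOn ℝ 2 V (X ×ˢ Y)) :
    ContinuousOn (gradX V) (interior X ×ˢ Y) := by
  intro z hz
  obtain ⟨F, hFc, hF⟩ := exists_local_gradX hV hz
  refine hFc.congr_of_eventuallyEq ?_ ?_
  · filter_upwards [hF] with w hw
    exact hw.gradient
  · exact (hF.self_of_nhdsWithin hz).gradient

/-! ### The reference measure -/

theorem refMeasure_eq_restrict {d d' : ℕ} {X : Set (Euc d)} {Y : Set (Euc d')}
    (hX : volume (frontier X) = 0) {ν : Measure (Euc d')} [SFinite ν] (hν : ν Yᶜ = 0) :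
    refMeasure X ν = ((volume : Measure (Euc d)).prod ν).restrict (interior X ×ˢ Y) := by
  have h1 : (volume : Measure (Euc d)).restrict (interior X) = volume.restrict X :=
    Measure.restrict_congr_set (interior_ae_eq_of_null_frontier hX)
  have h2 : ν.restrict Y = ν := Measure.restrict_eq_self_of_ae_mem (by
    rw [ae_iff]; exact hν)
  rw [refMeasure, ← Measure.prod_restrict, h1, h2]

theorem ae_ae_of_ae_refMeasure {d d' : ℕ} {X : Set (Euc d)} {ν : Measure (Euc d')} [SFinite ν]
    {p : Euc d × Euc d' → Prop} (h : ∀ᵐ z ∂(refMeasure X ν), p z) :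
    ∀ᵐ y ∂ν, ∀ᵐ x ∂(volume.restrict X), p (x, y) :=
  Measure.ae_ae_of_ae_prod ((Measure.measurePreserving_swap (μ := ν)
    (ν := volume.restrict X)).quasiMeasurePreserving.ae h)

/-- Slicewise equality gives equality on the product only for a measurable set of points, so
measurable representatives are compared instead. -/
theorem ae_eq_refMeasure_of_ae_ae {d d' : ℕ} {X : Set (Euc d)} {ν : Measure (Euc d')} [SFinite ν]
    {f g : Euc d × Euc d' → ℝ} (hf : AEMeasurable f (refMeasure X ν))
    (hg : AEMeasurable g (refMeasure X ν))
    (h : ∀ᵐ y ∂ν, ∀ᵐ x ∂(volume.restrict X), f (x, y) = g (x, y)) :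
    f =ᵐ[refMeasure X ν] g := by
  have h1 : ∀ᵐ y ∂ν, ∀ᵐ x ∂(volume.restrict X), hf.mk f (x, y) = hg.mk g (x, y) := by
    filter_upwards [h, ae_ae_of_ae_refMeasure hf.ae_eq_mk, ae_ae_of_ae_refMeasure hg.ae_eq_mk]
      with y h2 h3 h4
    filter_upwards [h2, h3, h4] with x h5 h6 h7
    rw [← h6, ← h7, h5]
  have hm : MeasurableSet {z : Euc d × Euc d' | hf.mk f z = hg.mk g z} :=
    measurableSet_eq_fun hf.measurable_mk hg.measurable_mk
  have h2 : hf.mk f =ᵐ[refMeasure X ν] hg.mk g :=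
    (Measure.ae_prod_iff_ae_ae hm).2 ((Measure.ae_ae_comm hm).2 h1)
  exact hf.ae_eq_mk.trans (h2.trans hg.ae_eq_mk.symm)

/-- If the dissipation vanishes, then `∇_X r = r (∇P - ∇_X V) / κ`. -/
theorem ae_hasWeakGradient_of_dissipation_eq_zero {d d' : ℕ} {X : Set (Euc d)} {Y : Set (Euc d')}
    (hX : IsCompact X) (hXf : volume (frontier X) = 0) (hY : IsCompact Y)
    {ν : Measure (Euc d')} [IsProbabilityMeasure ν] (hν : ν Yᶜ = 0)
    {V : Euc d × Euc d' → ℝ} (hV : ContDiffOn ℝ 2 V (X ×ˢ Y)) {κ : ℝ} (hκ : 0 < κ)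
    {r : Euc d × Euc d' → ℝ} (hr : AEMeasurable r (refMeasure X ν))
    (hr0 : 0 ≤ᵐ[refMeasure X ν] r) {P : Euc d → ℝ}
    (hP : HasWeakGradient (interior X) P (weakGradient (interior X) P))
    (hI : dissipation X ν V κ r P = 0) :
    ∀ᵐ y ∂ν, ∃ G, HasWeakGradient (interior X) (fun x => r (x, y)) G ∧
      ∀ᵐ x, x ∈ interior X →
        G x = r (x, y) • κ⁻¹ • (weakGradient (interior X) P x - gradX V (x, y)) := by
  have hex : ∃ w, HasWeakLogGradientX X ν r w := by
    by_contra h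
    simp [dissipation, h] at hI
  rw [dissipation, dif_pos hex] at hI
  set w := hex.choose
  have hw : HasWeakLogGradientX X ν r w := hex.choose_spec
  have href := refMeasure_eq_restrict (Y := Y) hXf hν
  have hUY : MeasurableSet (interior X ×ˢ Y) := isOpen_interior.measurableSet.prod hY.measurableSet
  have hac : measureOfDensity X ν r ≪ refMeasure X ν := withDensity_absolutelyContinuous _ _
  have mV : AEMeasurable (gradX V) (refMeasure X ν) := by
    rw [href]
    exact (continuousOn_gradX hV).aemeasurable hUY
  have mP : AEMeasurable (fun z : Euc d × Euc d' => weakGradient (interior X) P z.1)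
      (refMeasure X ν) := by
    have h1 : AEMeasurable (weakGradient (interior X) P) (volume.restrict X) := by
      rw [← Measure.restrict_congr_set (interior_ae_eq_of_null_frontier hXf)]
      exact hP.locallyIntegrable_gradient.aestronglyMeasurable.aemeasurable
    exact h1.comp_quasiMeasurePreserving Measure.quasiMeasurePreserving_fst
  have hz := (lintegral_eq_zero_iff' (by
    have h1 := (((hw.aestronglyMeasurable.aemeasurable.const_smul κ).add mV).sub mP).mono_ac hac
    exact h1.enorm.pow_const 2)).1 hI
  have hz' : ∀ᵐ z ∂(refMeasure X ν),
      r z • w z = r z • κ⁻¹ • (weakGradient (interior X) P z.1 - gradX V z) := by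
    -- A statement holding `ρ`-almost everywhere carries information only where `r > 0`; where `r =
    -- 0` both sides of the goal vanish.
    have h1 := (ae_withDensity_iff' hr.ennreal_ofReal).1 hz
    filter_upwards [h1, hr0] with z h2 h3
    rcases h3.eq_or_lt with h4 | h4
    · rw [← h4]; simp
    · have h5 := h2 (by simpa using h4)
      simp only [Pi.zero_apply, pow_eq_zero_iff, ne_eq, OfNat.ofNat_ne_zero, not_false_eq_true,
        enorm_eq_zero] at h5
      have h6 : κ • w z = weakGradient (interior X) P z.1 - gradX V z := by
        rw [← sub_eq_zero, ← h5]; abel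
      rw [← h6, smul_smul κ⁻¹, inv_mul_cancel₀ hκ.ne', one_smul]
  filter_upwards [hw.hasWeakGradient, ae_ae_of_ae_refMeasure hz'] with y h1 h2
  refine ⟨_, h1, ?_⟩
  have h3 := (ae_restrict_iff' hX.measurableSet).1 h2
  filter_upwards [h3] with x hx hxU
  exact hx (interior_subset hxU)

/-! ### Minimality -/

theorem isFiniteMeasure_refMeasure {d d' : ℕ} {X : Set (Euc d)} (hX : IsCompact X)
    (ν : Measure (Euc d')) [IsFiniteMeasure ν] : IsFiniteMeasure (refMeasure X ν) := by
  have : IsFiniteMeasure ((volume : Measure (Euc d)).restrict X) :=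
    isFiniteMeasure_restrict.2 hX.measure_lt_top.ne
  unfold refMeasure
  infer_instance

theorem integrable_fst_of_mem_couplings {d d' : ℕ} {μ : Measure (Euc d)} {ν : Measure (Euc d')}
    {σ : Measure (Euc d × Euc d')} (hσ : σ ∈ couplings μ ν) {P : Euc d → ℝ}
    (hP : Integrable P μ) :
    Integrable (fun z => P z.1) σ ∧ ∫ z, P z.1 ∂σ = ∫ x, P x ∂μ := by
  have h : MeasurePreserving Prod.fst σ μ := ⟨measurable_fst, hσ.2.1⟩
  refine ⟨h.integrable_comp_of_integrable hP, ?_⟩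
  rw [← h.map_eq, integral_map h.measurable.aemeasurable (by rw [h.map_eq]; exact hP.1)]

theorem integrable_snd_of_mem_couplings {d d' : ℕ} {μ : Measure (Euc d)} {ν : Measure (Euc d')}
    {σ : Measure (Euc d × Euc d')} (hσ : σ ∈ couplings μ ν) {Ψ : Euc d' → ℝ}
    (hΨ : Integrable Ψ ν) :
    Integrable (fun z => Ψ z.2) σ ∧ ∫ z, Ψ z.2 ∂σ = ∫ y, Ψ y ∂ν := by
  have h : MeasurePreserving Prod.snd σ ν := ⟨measurable_snd, hσ.2.2⟩
  refine ⟨h.integrable_comp_of_integrable hΨ, ?_⟩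
  rw [← h.map_eq, integral_map h.measurable.aemeasurable (by rw [h.map_eq]; exact hΨ.1)]

/-- The Bregman inequality for the entropy `t log t - t + 1`. -/
theorem one_sub_le_entropy_sub {s r : ℝ} (hs : 0 ≤ s) (hr : 0 < r) :
    1 - r ≤ s * Real.log s - s + 1 - s * Real.log r ∧
      (1 - r = s * Real.log s - s + 1 - s * Real.log r → s = r) := by
  have hq : 0 ≤ s / r := by positivity
  -- The gap is the relative entropy density `r * klFun (s / r)`, which is non-negative and vanishes
  -- only at `s = r`.
  have e : s * Real.log s - s + 1 - s * Real.log r - (1 - r) =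
      r * InformationTheory.klFun (s / r) := by
    rw [InformationTheory.klFun_apply]
    rcases hs.eq_or_lt with rfl | hs'
    · simp
    · rw [Real.log_div hs'.ne' hr.ne']
      field_simp
      ring
  have h0 := InformationTheory.klFun_nonneg hq
  refine ⟨by nlinarith, fun h => ?_⟩
  have h2 : InformationTheory.klFun (s / r) = 0 :=
    (mul_eq_zero.1 (e.symm.trans (sub_eq_zero.2 h.symm))).resolve_left hr.ne'
  rw [InformationTheory.klFun_eq_zero_iff hq, div_eq_one_iff_eq hr.ne'] at h2
  exact h2

/-- The energy of a coupling with finite entropy, expressed through potentials. -/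
theorem energy_eq_ofReal {d d' : ℕ} {X : Set (Euc d)} {μ : Measure (Euc d)} {ν : Measure (Euc d')}
    [IsFiniteMeasure (refMeasure X ν)]
    {V : Euc d × Euc d' → ℝ} {κ M : ℝ} (hκ : 0 < κ)
    (hVm : AEMeasurable V (refMeasure X ν))
    (hV : ∀ᵐ z ∂(refMeasure X ν), 0 ≤ V z ∧ V z ≤ M)
    {P : Euc d → ℝ} (hP : Integrable P μ) {Ψ : Euc d' → ℝ} (hΨ : Integrable Ψ ν)
    {σ : Measure (Euc d × Euc d')} (hσ : σ ∈ couplings μ ν) (hac : σ ≪ refMeasure X ν)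
    {s : Euc d × Euc d' → ℝ} (hs : (fun z => (σ.rnDeriv (refMeasure X ν) z).toReal)
      =ᵐ[refMeasure X ν] s)
    (hent : Integrable (fun z => s z * Real.log (s z) - s z + 1) (refMeasure X ν)) :
    Integrable (fun z => s z * Real.log (s z) - s z + 1 - s z * ((P z.1 + Ψ z.2 - V z) / κ))
      (refMeasure X ν) ∧
    energy X μ ν V κ σ = ENNReal.ofReal ((∫ x, P x ∂μ + ∫ y, Ψ y ∂ν) + κ *
      ∫ z, (s z * Real.log (s z) - s z + 1 - s z * ((P z.1 + Ψ z.2 - V z) / κ))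
        ∂(refMeasure X ν)) ∧
    0 ≤ (∫ x, P x ∂μ + ∫ y, Ψ y ∂ν) + κ *
      ∫ z, (s z * Real.log (s z) - s z + 1 - s z * ((P z.1 + Ψ z.2 - V z) / κ))
        ∂(refMeasure X ν) := by
  have := hσ.1
  obtain ⟨iP, eP⟩ := integrable_fst_of_mem_couplings hσ hP
  obtain ⟨iΨ, eΨ⟩ := integrable_snd_of_mem_couplings hσ hΨ
  have hVσ : ∀ᵐ z ∂σ, 0 ≤ V z ∧ V z ≤ M := hac.ae_le hV
  have iV : Integrable V σ := by
    refine Integrable.of_bound (hVm.mono_ac hac).aestronglyMeasurable M ?_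
    filter_upwards [hVσ] with z hz
    rw [Real.norm_eq_abs, abs_of_nonneg hz.1]
    exact hz.2
  have iL : Integrable (fun z => (P z.1 + Ψ z.2 - V z) / κ) σ := ((iP.add iΨ).sub iV).div_const κ
  have eL : κ * ∫ z, (P z.1 + Ψ z.2 - V z) / κ ∂σ =
      (∫ x, P x ∂μ + ∫ y, Ψ y ∂ν) - ∫ z, V z ∂σ := by
    rw [integral_div, mul_div_cancel₀ _ hκ.ne', integral_sub (f := fun z => P z.1 + Ψ z.2)
      (iP.add iΨ) iV, integral_add iP iΨ, eP, eΨ]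
  have isL : Integrable (fun z => s z * ((P z.1 + Ψ z.2 - V z) / κ)) (refMeasure X ν) := by
    refine ((integrable_rnDeriv_smul_iff hac).2 iL).congr ?_
    filter_upwards [hs] with z hz
    rw [hz, smul_eq_mul]
  have esL : ∫ z, s z * ((P z.1 + Ψ z.2 - V z) / κ) ∂(refMeasure X ν) =
      ∫ z, (P z.1 + Ψ z.2 - V z) / κ ∂σ := by
    rw [← integral_rnDeriv_smul hac]
    refine integral_congr_ae ?_
    filter_upwards [hs] with z hz
    rw [hz, smul_eq_mul]
  have hs0 : ∀ᵐ z ∂(refMeasure X ν), 0 ≤ s z := by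
    filter_upwards [hs] with z hz
    rw [← hz]
    exact ENNReal.toReal_nonneg
  have hent0 : ∀ᵐ z ∂(refMeasure X ν), 0 ≤ s z * Real.log (s z) - s z + 1 := by
    filter_upwards [hs0] with z hz
    have := InformationTheory.klFun_nonneg hz
    rw [InformationTheory.klFun_apply] at this
    linarith
  refine ⟨hent.sub isL, ?_⟩
  have e1 : entropy X ν σ =
      ENNReal.ofReal (∫ z, (s z * Real.log (s z) - s z + 1) ∂(refMeasure X ν)) := by
    rw [entropy, if_pos hac, ofReal_integral_eq_lintegral_ofReal hent hent0]
    refine lintegral_congr_ae ?_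
    filter_upwards [hs] with z hz
    simp only [hz]
  have hV0 : 0 ≤ ∫ z, V z ∂σ := integral_nonneg_of_ae (hVσ.mono fun z hz => hz.1)
  have hH0 := mul_nonneg hκ.le (integral_nonneg_of_ae hent0)
  have e2 : (∫ x, P x ∂μ + ∫ y, Ψ y ∂ν) + κ *
      ∫ z, (s z * Real.log (s z) - s z + 1 - s z * ((P z.1 + Ψ z.2 - V z) / κ))
        ∂(refMeasure X ν) =
      ∫ z, V z ∂σ + κ * ∫ z, (s z * Real.log (s z) - s z + 1) ∂(refMeasure X ν) := by
    rw [integral_sub hent isL, esL, mul_sub, eL]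
    ring
  rw [e2, energy, if_pos hσ, e1,
    ← ofReal_integral_eq_lintegral_ofReal iV (hVσ.mono fun z hz => hz.1),
    ← ENNReal.ofReal_mul hκ.le, ← ENNReal.ofReal_add hV0 hH0]
  exact ⟨rfl, add_nonneg hV0 hH0⟩

theorem isUniqueMinimizer_energy {d d' : ℕ} {X : Set (Euc d)} {μ : Measure (Euc d)}
    {ν : Measure (Euc d')} [IsFiniteMeasure (refMeasure X ν)]
    {V : Euc d × Euc d' → ℝ} {κ M : ℝ} (hκ : 0 < κ)
    (hVm : AEMeasurable V (refMeasure X ν))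
    (hV : ∀ᵐ z ∂(refMeasure X ν), 0 ≤ V z ∧ V z ≤ M)
    {P : Euc d → ℝ} (hP : Integrable P μ) {Ψ : Euc d' → ℝ} (hΨ : Integrable Ψ ν)
    {r : Euc d × Euc d' → ℝ} (hr : Integrable r (refMeasure X ν))
    (hre : r =ᵐ[refMeasure X ν] fun z => Real.exp ((P z.1 + Ψ z.2 - V z) / κ))
    (hρ : measureOfDensity X ν r ∈ couplings μ ν) :
    IsUniqueMinimizer (energy X μ ν V κ) (measureOfDensity X ν r) := by
  set R := refMeasure X ν with hR
  set ρ := measureOfDensity X ν r with hρdef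
  have hρac : ρ ≪ R := withDensity_absolutelyContinuous _ _
  have hρr : (fun z => (ρ.rnDeriv R z).toReal) =ᵐ[R] r := by
    filter_upwards [Measure.rnDeriv_withDensity₀ R hr.1.aemeasurable.ennreal_ofReal, hre]
      with z h1 h2
    have h1' : ρ.rnDeriv R z = ENNReal.ofReal (r z) := h1
    rw [h1', ENNReal.toReal_ofReal]
    rw [h2]
    positivity
  have := hρ.1
  obtain ⟨iP, -⟩ := integrable_fst_of_mem_couplings hρ hP
  obtain ⟨iΨ, -⟩ := integrable_snd_of_mem_couplings hρ hΨ
  have iV : Integrable V ρ := by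
    refine Integrable.of_bound (hVm.mono_ac hρac).aestronglyMeasurable M ?_
    filter_upwards [hρac.ae_le hV] with z hz
    rw [Real.norm_eq_abs, abs_of_nonneg hz.1]
    exact hz.2
  have iL : Integrable (fun z => (P z.1 + Ψ z.2 - V z) / κ) ρ := ((iP.add iΨ).sub iV).div_const κ
  have hent : Integrable (fun z => r z * Real.log (r z) - r z + 1) R := by
    refine Integrable.add (Integrable.sub ?_ hr) (integrable_const 1)
    -- Finite entropy of `r` follows from its form: `r log r` is `r` times the exponent, and the
    -- exponent is `ρ`-integrable.
    refine ((integrable_rnDeriv_smul_iff hρac).2 iL).congr ?_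
    filter_upwards [hρr, hre] with z h1 h2
    rw [h1, smul_eq_mul]
    congr 1
    rw [h2, Real.log_exp]
  obtain ⟨iρ, eρ, nρ⟩ := energy_eq_ofReal hκ hVm hV hP hΨ hρ hρac hρr hent
  intro σ hσρ
  rw [eρ]
  by_cases hσ : σ ∈ couplings μ ν
  swap
  · rw [energy, if_neg hσ]
    exact ENNReal.ofReal_lt_top
  by_cases hac : σ ≪ R
  swap
  · have : energy X μ ν V κ σ = ⊤ := by
      rw [energy, if_pos hσ, entropy, if_neg hac, ENNReal.mul_top (by simpa using hκ)]
      simp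
    rw [this]
    exact ENNReal.ofReal_lt_top
  set s : Euc d × Euc d' → ℝ := fun z => (σ.rnDeriv R z).toReal with hs
  have hs0 : ∀ z, 0 ≤ s z := fun z => ENNReal.toReal_nonneg
  have hsm : Measurable s := (Measure.measurable_rnDeriv σ R).ennreal_toReal
  by_cases hsent : Integrable (fun z => s z * Real.log (s z) - s z + 1) R
  swap
  · have h1 : entropy X ν σ = ⊤ := by
      rw [entropy, if_pos hac]
      by_contra h
      refine hsent ((lintegral_ofReal_ne_top_iff_integrable
        (Measurable.aestronglyMeasurable (by fun_prop)) (ae_of_all _ fun z => ?_)).1 h)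
      have := InformationTheory.klFun_nonneg (hs0 z)
      rw [InformationTheory.klFun_apply] at this
      simp only [Pi.zero_apply]
      linarith
    have : energy X μ ν V κ σ = ⊤ := by
      rw [energy, if_pos hσ, h1, ENNReal.mul_top (by simpa using hκ)]
      simp
    rw [this]
    exact ENNReal.ofReal_lt_top
  have := hσ.1
  obtain ⟨iσ, eσ, -⟩ := energy_eq_ofReal hκ hVm hV hP hΨ hσ hac (ae_eq_refl s) hsent
  have hle : (fun z => r z * Real.log (r z) - r z + 1 - r z * ((P z.1 + Ψ z.2 - V z) / κ)) ≤ᵐ[R]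
      fun z => s z * Real.log (s z) - s z + 1 - s z * ((P z.1 + Ψ z.2 - V z) / κ) := by
    filter_upwards [hre] with z hz
    have hlog : (P z.1 + Ψ z.2 - V z) / κ = Real.log (r z) := by rw [hz, Real.log_exp]
    have hpos : 0 < r z := by rw [hz]; positivity
    rw [hlog]
    linarith [(one_sub_le_entropy_sub (hs0 z) hpos).1]
  have hlt : ∫ z, (r z * Real.log (r z) - r z + 1 - r z * ((P z.1 + Ψ z.2 - V z) / κ)) ∂(R) <
      ∫ z, (s z * Real.log (s z) - s z + 1 - s z * ((P z.1 + Ψ z.2 - V z) / κ)) ∂(R) := by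
    refine lt_of_le_of_ne (integral_mono_ae iρ iσ hle) fun h => hσρ ?_
    have heq := (integral_eq_iff_of_ae_le iρ iσ hle).1 h
    have hsr : s =ᵐ[R] r := by
      filter_upwards [hre, heq] with z hz h1
      have hlog : (P z.1 + Ψ z.2 - V z) / κ = Real.log (r z) := by rw [hz, Real.log_exp]
      have hpos : 0 < r z := by rw [hz]; positivity
      rw [hlog] at h1
      exact (one_sub_le_entropy_sub (hs0 z) hpos).2 (by linarith)
    rw [← Measure.withDensity_rnDeriv_eq σ R hac, hρdef, measureOfDensity]
    refine withDensity_congr_ae ?_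
    filter_upwards [hsr, Measure.rnDeriv_lt_top σ R] with z h1 h2
    rw [← h1, hs, ENNReal.ofReal_toReal h2.ne]
  rw [eσ]
  exact (ENNReal.ofReal_lt_ofReal_iff_of_nonneg nρ).2 (by gcongr)

/-! ### The form of the density -/

theorem ae_lintegral_density_eq_one {d d' : ℕ} {X : Set (Euc d)} {μ : Measure (Euc d)}
    {ν : Measure (Euc d')} [IsFiniteMeasure ν] {r : Euc d × Euc d' → ℝ}
    (hr : AEMeasurable r (refMeasure X ν)) (hρ : measureOfDensity X ν r ∈ couplings μ ν) :
    ∀ᵐ y ∂ν, ∫⁻ x in X, ENNReal.ofReal (r (x, y)) = 1 := by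
  refine ae_eq_of_forall_setLIntegral_eq_of_sigmaFinite₀ (g := fun _ => 1)
    hr.ennreal_ofReal.lintegral_prod_left' aemeasurable_const fun S hS _ => ?_
  have h1 : measureOfDensity X ν r (Prod.snd ⁻¹' S) = ν S := by
    rw [← Measure.map_apply measurable_snd hS, hρ.2.2]
  have h2 : (refMeasure X ν).restrict (Prod.snd ⁻¹' S) =
      ((volume : Measure (Euc d)).restrict X).prod (ν.restrict S) := by
    rw [refMeasure, ← univ_prod, ← Measure.prod_restrict, Measure.restrict_univ]
  rw [setLIntegral_one, ← h1, measureOfDensity, withDensity_apply _ (measurable_snd hS), h2,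
    lintegral_prod_symm _ (by rw [← h2]; exact hr.ennreal_ofReal.restrict)]

/-- The constants `c` are chosen separately for each `y`, with no measurability. Normalization
identifies them with the inverse of the partition function, which is measurable by Tonelli; `Ψ` is
`-κ` times its logarithm. -/
theorem exists_potential {d d' : ℕ} {X : Set (Euc d)} {ν : Measure (Euc d')} [IsFiniteMeasure ν]
    {r e : Euc d × Euc d' → ℝ} {κ : ℝ} (hκ : 0 < κ) (hr : AEMeasurable r (refMeasure X ν))
    (he : AEMeasurable e (refMeasure X ν))
    (hone : ∀ᵐ y ∂ν, ∫⁻ x in X, ENNReal.ofReal (r (x, y)) = 1)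
    (h : ∀ᵐ y ∂ν, ∃ c : ℝ, ∀ᵐ x ∂(volume.restrict X),
      r (x, y) = c * Real.exp (κ⁻¹ * e (x, y))) :
    ∃ Ψ : Euc d' → ℝ, Measurable Ψ ∧
      r =ᵐ[refMeasure X ν] fun z => Real.exp ((Ψ z.2 + e z) / κ) := by
  have hem : AEMeasurable (fun z => Real.exp (κ⁻¹ * e z)) (refMeasure X ν) :=
    (he.const_mul _).exp
  have hZ : AEMeasurable (fun y => ∫⁻ x in X, ENNReal.ofReal (Real.exp (κ⁻¹ * e (x, y)))) ν :=
    hem.ennreal_ofReal.lintegral_prod_left'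
  have hΨ0 : AEMeasurable (fun y => -κ * Real.log
      (∫⁻ x in X, ENNReal.ofReal (Real.exp (κ⁻¹ * e (x, y)))).toReal) ν :=
    hZ.ennreal_toReal.log.const_mul _
  refine ⟨hΨ0.mk _, hΨ0.measurable_mk, ae_eq_refMeasure_of_ae_ae hr ?_ ?_⟩
  · exact ((((hΨ0.measurable_mk.comp measurable_snd).aemeasurable).add he).div_const κ).exp
  filter_upwards [h, hone, hΨ0.ae_eq_mk] with y ⟨c, hc⟩ h1 h2
  set Z := ∫⁻ x in X, ENNReal.ofReal (Real.exp (κ⁻¹ * e (x, y)))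
  -- This one identity yields `c > 0` and `0 < Z < ∞`, so neither `toReal` nor `log` takes a default
  -- value.
  have h3 : ENNReal.ofReal c * Z = 1 := by
    rw [← h1, ← lintegral_const_mul' _ _ ENNReal.ofReal_ne_top]
    refine lintegral_congr_ae ?_
    filter_upwards [hc] with x hx
    rw [hx, ENNReal.ofReal_mul' (Real.exp_pos _).le]
  have hZ0 : Z ≠ 0 := fun h => by simp [h] at h3
  have hc0 : ENNReal.ofReal c ≠ 0 := fun h => by simp [h] at h3
  have hZt : Z ≠ ⊤ := fun h => by simp [h, ENNReal.mul_top hc0] at h3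
  have hcpos : 0 < c := by simpa using hc0
  have hZpos : 0 < Z.toReal := ENNReal.toReal_pos hZ0 hZt
  have h4 : c * Z.toReal = 1 := by
    have := congrArg ENNReal.toReal h3
    rwa [ENNReal.toReal_mul, ENNReal.toReal_ofReal hcpos.le, ENNReal.toReal_one] at this
  filter_upwards [hc] with x hx
  rw [hx, ← h2, add_div, Real.exp_add]
  congr 1
  · rw [neg_mul, neg_div, mul_div_cancel_left₀ _ hκ.ne', Real.exp_neg, Real.exp_log hZpos]
    exact eq_inv_of_mul_eq_one_left h4
  · congr 1
    field_simp

/-- The potential `Ψ` is essentially bounded if `V` is. -/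
theorem exists_bound_potential {d d' : ℕ} {X : Set (Euc d)} {ν : Measure (Euc d')}
    [IsProbabilityMeasure ν] {V r : Euc d × Euc d' → ℝ} {P : Euc d → ℝ} {Ψ : Euc d' → ℝ}
    {κ M : ℝ} (hκ : 0 < κ) (hV : ∀ᵐ z ∂(refMeasure X ν), 0 ≤ V z ∧ V z ≤ M)
    (hone : ∀ᵐ y ∂ν, ∫⁻ x in X, ENNReal.ofReal (r (x, y)) = 1)
    (hre : r =ᵐ[refMeasure X ν] fun z => Real.exp ((P z.1 + Ψ z.2 - V z) / κ)) :
    ∃ C, ∀ᵐ y ∂ν, ‖Ψ y‖ ≤ C := by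
  have hall := (ae_ae_of_ae_refMeasure hV).and (hone.and (ae_ae_of_ae_refMeasure hre))
  obtain ⟨y₀, hV₀, hone₀, hre₀⟩ := hall.exists
  have key : ∀ y₁ y₂, (∀ᵐ x ∂(volume.restrict X), 0 ≤ V (x, y₁) ∧ V (x, y₁) ≤ M) →
      (∀ᵐ x ∂(volume.restrict X), 0 ≤ V (x, y₂) ∧ V (x, y₂) ≤ M) →
      (∫⁻ x in X, ENNReal.ofReal (r (x, y₁)) = 1) → (∫⁻ x in X, ENNReal.ofReal (r (x, y₂)) = 1) →
      (∀ᵐ x ∂(volume.restrict X), r (x, y₁) = Real.exp ((P x + Ψ y₁ - V (x, y₁)) / κ)) →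
      (∀ᵐ x ∂(volume.restrict X), r (x, y₂) = Real.exp ((P x + Ψ y₂ - V (x, y₂)) / κ)) →
      Ψ y₁ ≤ Ψ y₂ + M := by
    intro y₁ y₂ hV1 hV2 h1 h2 hr1 hr2
    -- As `V` varies by at most `M`, `r(x, y₁)` dominates `exp((Ψ y₁ - Ψ y₂ - M) / κ) r(x, y₂)`.
    -- Both slices have mass one, so the factor is at most one.
    have hle : ENNReal.ofReal (Real.exp ((Ψ y₁ - Ψ y₂ - M) / κ)) * 1 ≤ 1 := by
      calc ENNReal.ofReal (Real.exp ((Ψ y₁ - Ψ y₂ - M) / κ)) * 1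
          = ∫⁻ x in X, ENNReal.ofReal (Real.exp ((Ψ y₁ - Ψ y₂ - M) / κ)) *
              ENNReal.ofReal (r (x, y₂)) := by
            rw [lintegral_const_mul' _ _ ENNReal.ofReal_ne_top, h2]
        _ ≤ ∫⁻ x in X, ENNReal.ofReal (r (x, y₁)) := by
            refine lintegral_mono_ae ?_
            filter_upwards [hV1, hV2, hr1, hr2] with x a1 a2 a3 a4
            rw [← ENNReal.ofReal_mul (Real.exp_pos _).le, a3, a4, ← Real.exp_add, ← add_div]
            gcongr
            linarith [a1.2, a2.1]
        _ = 1 := h1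
    rw [mul_one, ENNReal.ofReal_le_one, Real.exp_le_one_iff, div_le_iff₀ hκ, zero_mul] at hle
    linarith
  refine ⟨|Ψ y₀| + |M|, ?_⟩
  filter_upwards [hall] with y ⟨hVy, hy, hry⟩
  have h1 := key y y₀ hVy hV₀ hy hone₀ hry hre₀
  have h2 := key y₀ y hV₀ hVy hone₀ hy hre₀ hry
  rw [Real.norm_eq_abs, abs_le]
  constructor <;> linarith [le_abs_self (Ψ y₀), neg_abs_le (Ψ y₀), le_abs_self M]

theorem IsAdmissibleMarginal.integrable {d : ℕ} {X : Set (Euc d)} (hX : IsCompact X)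
    {μ : Measure (Euc d)} (hμ : IsAdmissibleMarginal X μ) {P : Euc d → ℝ} (hP : MemH1 X P) :
    Integrable P μ := by
  obtain ⟨m, hm, ⟨a, b, ha, hab⟩, rfl, -⟩ := hμ.density
  have : IsFiniteMeasure ((volume : Measure (Euc d)).restrict X) :=
    isFiniteMeasure_restrict.2 hX.measure_lt_top.ne
  have h1 : Integrable P (volume.restrict X) := hP.1.integrable one_le_two
  rw [integrable_withDensity_iff_integrable_smul' hm.ennreal_ofReal (by simp)]
  refine h1.bdd_smul b hm.ennreal_ofReal.ennreal_toReal.aestronglyMeasurable ?_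
  filter_upwards [ae_restrict_mem hX.measurableSet] with x hx
  have h2 := hab x hx
  rw [ENNReal.toReal_ofReal (by linarith), Real.norm_eq_abs, abs_of_nonneg (by linarith)]
  exact h2.2

end Multiphase

theorem mainTheorem5 {d d' : ℕ}
    (X : Set (Multiphase.Euc d)) (hX : IsCompact X) (hXconn : IsConnected (interior X))
    (hXsmooth : Multiphase.HasSmoothBoundary X)
    (Y : Set (Multiphase.Euc d')) (hY : IsCompact Y)
    (μ : Measure (Multiphase.Euc d)) (hμ : Multiphase.IsAdmissibleMarginal X μ)
    (ν : Measure (Multiphase.Euc d')) [IsProbabilityMeasure ν] (hν : ν Yᶜ = 0)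
    (V : Multiphase.Euc d × Multiphase.Euc d' → ℝ) (hV : ContDiffOn ℝ 2 V (X ×ˢ Y))
    (hV0 : ∀ z ∈ X ×ˢ Y, 0 ≤ V z)
    (κ : ℝ) (hκ : 0 < κ)
    (ρ : Measure (Multiphase.Euc d × Multiphase.Euc d')) (hρ : ρ ∈ Multiphase.couplings μ ν)
    (r : Multiphase.Euc d × Multiphase.Euc d' → ℝ)
    (hr : Integrable r (Multiphase.refMeasure X ν)) (hr0 : 0 ≤ᵐ[Multiphase.refMeasure X ν] r)
    (hρr : ρ = Multiphase.measureOfDensity X ν r)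
    (P : Multiphase.Euc d → ℝ) (hP : Multiphase.IsPressure X μ ν V κ r P)
    (hI : Multiphase.dissipation X ν V κ r P = 0) :
    (∃ Ψ : Multiphase.Euc d' → ℝ, Measurable Ψ ∧
      r =ᵐ[Multiphase.refMeasure X ν] fun z => Real.exp ((P z.1 + Ψ z.2 - V z) / κ)) ∧
    Multiphase.IsUniqueMinimizer (Multiphase.energy X μ ν V κ) ρ := by
  subst hρr
  have hXf : volume (frontier X) = 0 := hXsmooth.volume_frontier
  have hfin := Multiphase.isFiniteMeasure_refMeasure hX ν
  have hUX : (interior X : Set (Multiphase.Euc d)) =ᵐ[volume] X :=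
    interior_ae_eq_of_null_frontier hXf
  have hPw : Multiphase.HasWeakGradient (interior X) P
      (Multiphase.weakGradient (interior X) P) := by
    have hex : ∃ g, Multiphase.HasWeakGradient (interior X) P g := hP.memH1.2.imp fun g h => h.1
    rw [Multiphase.weakGradient, dif_pos hex]
    exact hex.choose_spec
  have hUY : MeasurableSet (interior X ×ˢ Y) := isOpen_interior.measurableSet.prod hY.measurableSet
  have hsub : interior X ×ˢ Y ⊆ X ×ˢ Y := prod_mono interior_subset le_rfl
  have href := Multiphase.refMeasure_eq_restrict hXf hν
  have hVm : AEMeasurable V (Multiphase.refMeasure X ν) := by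
    rw [href]
    exact (hV.continuousOn.mono hsub).aemeasurable hUY
  obtain ⟨M, hM⟩ := (hX.prod hY).exists_bound_of_continuousOn hV.continuousOn
  have hVb : ∀ᵐ z ∂(Multiphase.refMeasure X ν), 0 ≤ V z ∧ V z ≤ M := by
    rw [href]
    filter_upwards [ae_restrict_mem hUY] with z hz
    exact ⟨hV0 z (hsub hz), (le_abs_self _).trans (hM z (hsub hz))⟩
  have hPm : AEMeasurable (fun z : Multiphase.Euc d × Multiphase.Euc d' => P z.1)
      (Multiphase.refMeasure X ν) :=
    hP.memH1.1.1.aemeasurable.comp_quasiMeasurePreserving Measure.quasiMeasurePreserving_fst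
  have hone := Multiphase.ae_lintegral_density_eq_one hr.1.aemeasurable hρ
  have hslice : ∀ᵐ y ∂ν, ∃ c : ℝ, ∀ᵐ x ∂(volume.restrict X),
      r (x, y) = c * Real.exp (κ⁻¹ * (P x - V (x, y))) := by
    have hνY : ∀ᵐ y ∂ν, y ∈ Y := by rw [ae_iff]; exact hν
    filter_upwards [hνY, Multiphase.ae_hasWeakGradient_of_dissipation_eq_zero hX hXf hY hν hV hκ
      hr.1.aemeasurable hr0 hPw hI] with y hy ⟨G, hG, hGe⟩
    obtain ⟨c, hc⟩ := Multiphase.exists_eq_const_mul_exp isOpen_interior hXconn.isPreconnected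
      hG hPw (V := fun x => V (x, y)) (fun x hx => Multiphase.hasGradientAt_gradX hV hx hy)
      ((Multiphase.continuousOn_gradX hV).comp (by fun_prop) fun x hx => ⟨hx, hy⟩) hGe
    refine ⟨c, ?_⟩
    rw [← Measure.restrict_congr_set hUX]
    exact (ae_restrict_iff' isOpen_interior.measurableSet).2 hc
  obtain ⟨Ψ, hΨm, hΨ⟩ := Multiphase.exists_potential (e := fun z => P z.1 - V z) hκ
    hr.1.aemeasurable (hPm.sub hVm) hone hslice
  have hre : r =ᵐ[Multiphase.refMeasure X ν] fun z => Real.exp ((P z.1 + Ψ z.2 - V z) / κ) := by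
    refine hΨ.trans (ae_of_all _ fun z => ?_)
    simp only
    congr 2
    ring
  obtain ⟨C, hC⟩ := Multiphase.exists_bound_potential hκ hVb hone hre
  exact ⟨⟨Ψ, hΨm, hre⟩, Multiphase.isUniqueMinimizer_energy hκ hVm hVb
    (hμ.integrable hX hP.memH1) (Integrable.of_bound hΨm.aestronglyMeasurable C hC) hr hre hρ⟩
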